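/- Setting. Let $X$ be a finite set of points and let $S:X\times X\to\mathbb R$ be a symmetric similarity function; for nonempty finite $A,B\subseteq X$ let $S(A,B)=\frac1{|A||B|}\sum_{x\in A,y\in B}S(x,y)$. A clustering of $X$ is a partition of $X$ into nonempty clusters. Let $\mathcal C^*$ be a target clustering with $k$ clusters that is stable: for all distinct $D,D'\in\mathcal C^*$, all nonempty $A\subsetneq D$ and all nonempty $A'\subseteq D'$, $S(A,D\setminus A)>S(A,A')$. Let $T$ be an average-linkage tree of $X$: start with the one-point trees and repeatedly join two trees with point sets $N_1,N_2$ that maximize $S(N_1,N_2)$ under a new root (ties broken arbitrarily) until one tree is left. For a set $A$ of at least two points, let $\mathrm{Split}(A)=\{N_1\cap A,N_2\cap A\}$, where $N_1,N_2$ are the children of the deepest node of $T$ that contains $A$. Algorithms. Starting from an initial clustering $\mathcal C_0$, the current clustering $\mathcal C$ is edited as follows. On a request split$(A)$, the cluster $A$ is replaced by the two sets of $\mathrm{Split}(A)$. On a request merge$(A,B)$, the clusters $A,B$ are replaced by $A\cup B$ if $\mathrm{Split}(A\cup B)=\{A,B\}$, and by the two sets of $\mathrm{Split}(A\cup B)$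 otherwise. Requests (unrestricted-merge model with random merges). As long as $\mathcal C\neq\mathcal C^*$, the user makes one feasible request in each round. The request split$(A)$ is feasible if $A\in\mathcal C$ contains points of at least two target clusters; the request merge$(A,B)$, for an unordered pair of distinct $A,B\in\mathcal C$, is feasible if some target cluster has points both in $A$ and in $B$. The choice between a split and a merge, and the choice of the split, are arbitrary (possibly random, and possibly depending on the whole history), but given the history and the event that a merge is requested, the requested pair is uniformly distributed on the set of currently feasible merges. Natural errors. A natural clustering error is a function $\gamma$ that assigns to a clustering $\mathcal C$ and a target clustering $\mathcal C^*$ a nonnegative integer $\gamma(\mathcal C,\mathcal C^*)$ such that (i) if $A\in\mathcal C$ contains points of $D\in\mathcal C^*$ and also points of other target clusters, then replacing $A$ by $A\cap D$ and $A\setminus D$ strictly decreases the error, and (ii) if two distinct clusters of $\mathcal C$ are contained in the same target cluster, then replacing them by their union strictly decreases the error. Theorem. There is a universal constant $K>0$ such that, for all $X,S,\mathcal C^*,T,\mathcal C_0$ as above, every user as above, every natural clustering error $\gamma$, and every $\varepsilon\in(0,1)$ with $k/\varepsilon\ge 2$ (that is, $k\ge2$ or $\varepsilon\le\frac12$), with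 probability at least $1-\varepsilon$ the target clustering $\mathcal C^*$ is found after at most $$K\,\log\!\Big(\frac{k}{\varepsilon}\Big)\,\gamma(\mathcal C_0,\mathcal C^*)^2$$ edit requests (splits and merges together). -/

import Mathlib

namespace InteractiveClustering

/-- A clustering of the data set `X`: a partition of `X` into nonempty, pairwise disjoint
clusters. -/
abbrev Clustering (X : Type*) [Fintype X] [DecidableEq X] :=
  Finpartition (Finset.univ : Finset X)

/-- The average similarity `S(A, B)` between the points of `A` and the points of `B`. -/
noncomputable def avgSim {X : Type*} (S : X → X → ℝ) (A B : Finset X) : ℝ :=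
  (∑ x ∈ A, ∑ y ∈ B, S x y) / ((A.card : ℝ) * (B.card : ℝ))

/-- Stability of a clustering with respect to a similarity function: for distinct clusters
`D, D'`, every nonempty proper subset `A` of `D` and every nonempty subset `A'` of `D'`,
`S(A, D \ A) > S(A, A')`. -/
def IsStable {X : Type*} [Fintype X] [DecidableEq X]
    (S : X → X → ℝ) (C : Clustering X) : Prop :=
  ∀ D ∈ C.parts, ∀ D' ∈ C.parts, D ≠ D' →
    ∀ A A' : Finset X, A.Nonempty → A ⊂ D → A'.Nonempty → A' ⊆ D' →
      avgSim S A A' < avgSim S A (D \ A)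

/-! ### Average linkage -/

/-- Hierarchical clustering trees: leaves carry points, inner nodes have two children. -/
inductive HTree (X : Type*) where
  | leaf (x : X) : HTree X
  | node (l r : HTree X) : HTree X

/-- The set of points contained in (the root of) a tree. -/
def HTree.points {X : Type*} [DecidableEq X] : HTree X → Finset X
  | .leaf x => {x}
  | .node l r => l.points ∪ r.points

/-- One iteration of average linkage on the current forest: two most similar nodes (ties broken
arbitrarily) are joined under a new node. -/
def AvgLinkageStep {X : Type*} [DecidableEq X] (S : X → X → ℝ)
    (F F' : Multiset (HTree X)) : Prop :=
  ∃ (N₁ N₂ : HTree X) (R : Multiset (HTree X)),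
    F = N₁ ::ₘ N₂ ::ₘ R ∧
    (∀ (M₁ M₂ : HTree X) (R' : Multiset (HTree X)), F = M₁ ::ₘ M₂ ::ₘ R' →
      avgSim S M₁.points M₂.points ≤ avgSim S N₁.points N₂.points) ∧
    F' = HTree.node N₁ N₂ ::ₘ R

/-- `T` is a (global) average-linkage tree of `X`: it is the single tree left when average linkage
is run from the forest of all one-point trees. -/
def IsAvgLinkageTree {X : Type*} [Fintype X] [DecidableEq X] (S : X → X → ℝ)
    (T : HTree X) : Prop :=
  Relation.ReflTransGen (AvgLinkageStep S)
    ((Finset.univ : Finset X).val.map HTree.leaf) {T}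

/-! ### The split and merge procedures -/

/-- Follow the points of `A` down the tree to the node at which they are first split in two, and
return the parts of `A` in the two children of this node. (The value at a leaf is never used:
a set with two points of the tree is split above the leaves.) -/
def HTree.splitSet {X : Type*} [DecidableEq X] : HTree X → Finset X → Finset X × Finset X
  | .leaf _, A => (A, ∅)
  | .node l r, A =>
    if A ⊆ l.points then l.splitSet A
    else if A ⊆ r.points then r.splitSet A
    else (l.points ∩ A, r.points ∩ A)

/-- Split procedure: replace the cluster `A` by the two parts found in the tree. -/
def splitProc {X : Type*} [DecidableEq X] (T : HTree X) (C : Finset (Finset X))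
    (A : Finset X) : Finset (Finset X) :=
  C.erase A ∪ {(T.splitSet A).1, (T.splitSet A).2}

/-- Merge procedure for the unordered pair of clusters `M = {A, B}`: split the union `A ∪ B` with
the tree; if the two parts are again `A` and `B`, replace `A` and `B` by `A ∪ B`, and otherwise
replace them by the two parts. -/
def mergeProc {X : Type*} [DecidableEq X] (T : HTree X) (C : Finset (Finset X))
    (M : Finset (Finset X)) : Finset (Finset X) :=
  if ({(T.splitSet (M.sup id)).1, (T.splitSet (M.sup id)).2} : Finset (Finset X)) = M then
    (C \ M) ∪ {M.sup id}
  else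
    (C \ M) ∪ {(T.splitSet (M.sup id)).1, (T.splitSet (M.sup id)).2}

/-! ### Requests and the unrestricted-merge model -/

/-- Edit requests: split a cluster, or merge an unordered pair `{A, B}` of clusters. -/
inductive Request (X : Type*) where
  | split (A : Finset X) : Request X
  | merge (M : Finset (Finset X)) : Request X

/-- A split of `A` is feasible if `A` is a current cluster that contains points from two or more
target clusters. -/
def FeasibleSplit {X : Type*} [Fintype X] [DecidableEq X]
    (Cstar : Clustering X) (C : Finset (Finset X)) (A : Finset X) : Prop :=
  A ∈ C ∧ ∃ D ∈ Cstar.parts, ∃ D' ∈ Cstar.parts, D ≠ D' ∧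
    (A ∩ D).Nonempty ∧ (A ∩ D').Nonempty

/-- A merge of the pair `M` is feasible if `M` consists of two distinct current clusters that both
contain at least one point of a common target cluster. -/
def FeasibleMerge {X : Type*} [Fintype X] [DecidableEq X]
    (Cstar : Clustering X) (C : Finset (Finset X)) (M : Finset (Finset X)) : Prop :=
  M ⊆ C ∧ M.card = 2 ∧ ∃ D ∈ Cstar.parts, ∀ A ∈ M, (A ∩ D).Nonempty

/-- Feasible requests of the unrestricted-merge model. -/
def Feasible {X : Type*} [Fintype X] [DecidableEq X]
    (Cstar : Clustering X) (C : Finset (Finset X)) : Request X → Prop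
  | .split A => FeasibleSplit Cstar C A
  | .merge M => FeasibleMerge Cstar C M

/-- The response of the algorithm to a request. -/
def respond {X : Type*} [DecidableEq X] (T : HTree X) (C : Finset (Finset X)) :
    Request X → Finset (Finset X)
  | .split A => splitProc T C A
  | .merge M => mergeProc T C M

/-- The current clustering after the requests in `h` (most recent request first), starting from
the clustering `C₀`. -/
def current {X : Type*} [DecidableEq X] (T : HTree X) (C₀ : Finset (Finset X)) :
    List (Request X) → Finset (Finset X)
  | [] => C₀
  | r :: h => respond T (current T C₀ h) r

/-- The law of the request history after `n` rounds. The user is given by the conditional law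
`user h` of the next request given the history `h` of all earlier requests. The interaction stops
(no further request is made) as soon as the target clustering is found. -/
noncomputable def history {X : Type*} [Fintype X] [DecidableEq X] (T : HTree X)
    (Cstar C₀ : Clustering X) (user : List (Request X) → PMF (Request X)) :
    ℕ → PMF (List (Request X))
  | 0 => PMF.pure []
  | n + 1 => (history T Cstar C₀ user n).bind fun h =>
      if current T C₀.parts h = Cstar.parts then PMF.pure h
      else (user h).map fun r => r :: h

/-- The user follows the unrestricted-merge model with uniformly random merge requests: at every
history that occurs with positive probability and has not yet reached the target, only feasible
requests are made, and all merges that are feasible at this moment are equally likely to be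
requested. The split requests, and the choice between splitting and merging, are arbitrary: they
may be random and may depend on the whole history. -/
def IsUnrestrictedRandomMergeUser {X : Type*} [Fintype X] [DecidableEq X] (T : HTree X)
    (Cstar C₀ : Clustering X) (user : List (Request X) → PMF (Request X)) : Prop :=
  ∀ (n : ℕ), ∀ h ∈ (history T Cstar C₀ user n).support,
    current T C₀.parts h ≠ Cstar.parts →
      (∀ r ∈ (user h).support, Feasible Cstar (current T C₀.parts h) r) ∧
      (∀ M M' : Finset (Finset X),
        FeasibleMerge Cstar (current T C₀.parts h) M →
        FeasibleMerge Cstar (current T C₀.parts h) M' →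
        user h (Request.merge M) = user h (Request.merge M'))

/-- The probability that the target clustering is found with at most `n` edit requests. -/
noncomputable def probFoundWithin {X : Type*} [Fintype X] [DecidableEq X] (T : HTree X)
    (Cstar C₀ : Clustering X) (user : List (Request X) → PMF (Request X)) (n : ℕ) : ENNReal :=
  (history T Cstar C₀ user n).toOuterMeasure {h | current T C₀.parts h = Cstar.parts}

/-! ### Natural clustering errors -/

/-- `γ C Cstar` is a natural clustering error of the clustering `C` with respect to the target
`Cstar`: a nonnegative integer that decreases when a cluster `A` containing points of a target
cluster `D` and other points is split into `A ∩ D` and `A \ D`, and when two clusters contained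
in a common target cluster are merged. -/
structure IsNaturalError {X : Type*} [Fintype X] [DecidableEq X]
    (γ : Clustering X → Clustering X → ℤ) : Prop where
  nonneg : ∀ C Cstar : Clustering X, 0 ≤ γ C Cstar
  split_lt : ∀ (Cstar C C' : Clustering X), ∀ A ∈ C.parts, ∀ D ∈ Cstar.parts,
    (A ∩ D).Nonempty → (A \ D).Nonempty →
    C'.parts = C.parts.erase A ∪ {A ∩ D, A \ D} → γ C' Cstar < γ C Cstar
  merge_lt : ∀ (Cstar C C' : Clustering X), ∀ A ∈ C.parts, ∀ B ∈ C.parts, A ≠ B →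
    (∃ D ∈ Cstar.parts, A ⊆ D ∧ B ⊆ D) →
    C'.parts = (C.parts \ {A, B}) ∪ {A ∪ B} → γ C' Cstar < γ C Cstar

end InteractiveClustering

open InteractiveClustering

/-!
Stability makes every node of an average-linkage tree laminar with respect to the target: it is
contained in a target cluster or is a union of target clusters. The rest is a drift argument. Call
the parts of `Split(D)`, for the target clusters `D`, the halves. A cluster meeting `p` target
clusters and `h` halves gets weight `2 * p + h - 1`, and the potential `Φ` is the total weight minus
that of the target. A split decreases `Φ`, and so does every merge request except possibly one of
two clusters inside the same half, which never increases `Φ`. Every cluster of such an internal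
merge also has an external feasible merge, with a cluster meeting the other half, while a target
cluster meets at most `Φ + 1` clusters. Hence there are at most `2 * (Φ + 1)` times as many internal
as external merges, and a uniformly random merge decreases `Φ` with probability of order
`1 / (Φ + 1)`. In expectation, `2 ^ Φ` (set to `0` at the target) thus shrinks by a factor
`1 - c / (Φ + 1)` with each request, where `Φ` is bounded by its initial value. Finally `Φ` is at
most three times the number of edits leading to the target, each of which decreases every natural
error, so that `Φ ≤ 3 * γ`, and Markov's inequality applies.
-/

namespace InteractiveClustering

open Finset
open scoped ENNReal

section Exchange

variable {α : Type*} [DecidableEq α] {s U A B : Finset α} {M : Finset (Finset α)}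

/-- The partition of `U = A ∪ B` into the disjoint sets `A` and `B`. If one of the two sets is
empty, it is left out. -/
def pairPartition (hd : Disjoint A B) (hU : A ∪ B = U) : Finpartition U :=
  .ofErase {A, B} ((supIndep_iff_pairwiseDisjoint).2 (by
    simpa [Set.pairwiseDisjoint_insert] using fun _ => hd)) (by simpa using hU)

theorem mem_pairPartition {hd : Disjoint A B} {hU : A ∪ B = U} {N : Finset α} :
    N ∈ (pairPartition hd hU).parts ↔ N.Nonempty ∧ (N = A ∨ N = B) := by
  simp [pairPartition, nonempty_iff_ne_empty]

theorem pairPartition_parts {hd : Disjoint A B} {hU : A ∪ B = U} (hA : A.Nonempty)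
    (hB : B.Nonempty) : (pairPartition hd hU).parts = {A, B} := by
  ext N
  simp only [mem_pairPartition, mem_insert, mem_singleton, and_iff_right_iff_imp]
  rintro (rfl | rfl) <;> assumption

theorem disjoint_exchange (P : Finpartition s) (hM : M ⊆ P.parts)
    (Q : Finpartition (M.sup id)) (hA : A ∈ P.parts \ M) (hB : B ∈ Q.parts) :
    Disjoint A B := by
  rw [mem_sdiff] at hA
  refine Disjoint.mono_right (Q.le hB) ((Finset.disjoint_sup_right).2 fun N hN => ?_)
  exact P.disjoint hA.1 (hM hN) (by rintro rfl; exact hA.2 hN)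

/-- The partition obtained from `P` by exchanging the parts in `M` for a partition of their
union. -/
def exchange (P : Finpartition s) (hM : M ⊆ P.parts) (Q : Finpartition (M.sup id)) :
    Finpartition s where
  parts := P.parts \ M ∪ Q.parts
  supIndep := by
    rw [supIndep_iff_pairwiseDisjoint, coe_union, Set.pairwiseDisjoint_union]
    exact ⟨P.disjoint.subset (mod_cast sdiff_subset), Q.disjoint,
      fun A hA B hB _ => disjoint_exchange P hM Q hA hB⟩
  sup_parts := by
    rw [sup_union, Q.sup_parts, ← sup_union, sdiff_union_of_subset hM, P.sup_parts]
  bot_notMem h := (mem_union.1 h).elim (fun h => P.bot_notMem (mem_sdiff.1 h).1) Q.bot_notMem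

theorem exchange_parts (P : Finpartition s) (hM : M ⊆ P.parts) (Q : Finpartition (M.sup id)) :
    (exchange P hM Q).parts = P.parts \ M ∪ Q.parts :=
  rfl

theorem disjoint_parts_exchange (P : Finpartition s) (hM : M ⊆ P.parts)
    (Q : Finpartition (M.sup id)) : Disjoint (P.parts \ M) Q.parts :=
  disjoint_left.2 fun _A hA hAQ =>
    Q.ne_empty hAQ (disjoint_self.1 (disjoint_exchange P hM Q hA hAQ))

theorem exchange_parts_val (P : Finpartition s) (hM : M ⊆ P.parts) (Q : Finpartition (M.sup id)) :
    (exchange P hM Q).parts.val = Q.parts.val + (P.parts.val - M.val) := by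
  rw [exchange_parts, ← disjUnion_eq_union _ _ (disjoint_parts_exchange P hM Q), disjUnion_val,
    sdiff_val, add_comm]

theorem sum_exchange {β : Type*} [AddCommGroup β] (P : Finpartition s) (hM : M ⊆ P.parts)
    (Q : Finpartition (M.sup id)) (w : Finset α → β) :
    ∑ A ∈ (exchange P hM Q).parts, w A =
      ∑ A ∈ P.parts, w A - ∑ A ∈ M, w A + ∑ A ∈ Q.parts, w A := by
  rw [exchange_parts, sum_union (disjoint_parts_exchange P hM Q), sum_sdiff_eq_sub hM]

end Exchange

section Tree

variable {X : Type*} [DecidableEq X] {T : HTree X} {A B D : Finset X}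

theorem HTree.points_nonempty (T : HTree X) : T.points.Nonempty := by
  induction T with
  | leaf x => exact singleton_nonempty x
  | node l r hl _ => exact hl.mono subset_union_left

/-- The subtrees of a tree, one for every node. -/
def HTree.subtrees {X : Type*} : HTree X → Set (HTree X)
  | .leaf x => {.leaf x}
  | .node l r => insert (.node l r) (l.subtrees ∪ r.subtrees)

theorem HTree.mem_subtrees_self {X : Type*} (T : HTree X) : T ∈ T.subtrees := by
  cases T <;> simp [HTree.subtrees]

theorem HTree.children_mem_subtrees {X : Type*} {T l r : HTree X} (h : .node l r ∈ T.subtrees) :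
    l ∈ T.subtrees ∧ r ∈ T.subtrees := by
  induction T with
  | leaf x => cases h
  | node l' r' hl hr =>
    rcases h with h | h | h
    · cases h
      exact ⟨.inr (.inl l.mem_subtrees_self), .inr (.inr r.mem_subtrees_self)⟩
    · exact (hl h).imp (fun h => .inr (.inl h)) fun h => .inr (.inl h)
    · exact (hr h).imp (fun h => .inr (.inr h)) fun h => .inr (.inr h)

/-- A tree is proper if no point occurs below both children of a node. -/
def HTree.IsProper (T : HTree X) : Prop :=
  ∀ l r : HTree X, .node l r ∈ T.subtrees → Disjoint l.points r.points

theorem HTree.isProper_leaf (x : X) : (HTree.leaf x).IsProper := by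
  simp [HTree.IsProper, HTree.subtrees]

theorem HTree.isProper_node {l r : HTree X} :
    (HTree.node l r).IsProper ↔ Disjoint l.points r.points ∧ l.IsProper ∧ r.IsProper := by
  simp only [HTree.IsProper, HTree.subtrees, Set.mem_insert_iff, Set.mem_union, HTree.node.injEq]
  grind

theorem HTree.splitSet_union (T : HTree X) (hA : A ⊆ T.points) :
    (T.splitSet A).1 ∪ (T.splitSet A).2 = A := by
  induction T with
  | leaf x => simp [HTree.splitSet]
  | node l r hl hr =>
    rw [HTree.splitSet]
    split_ifs with h h'
    · exact hl h
    · exact hr h'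
    · rw [← union_inter_distrib_right]
      exact inter_eq_right.2 hA

theorem HTree.IsProper.disjoint_splitSet (hT : T.IsProper) (A : Finset X) :
    Disjoint (T.splitSet A).1 (T.splitSet A).2 := by
  induction T with
  | leaf x => simp [HTree.splitSet]
  | node l r hl hr =>
    rw [HTree.isProper_node] at hT
    rw [HTree.splitSet]
    split_ifs
    · exact hl hT.2.1
    · exact hr hT.2.2
    · exact hT.1.mono inter_subset_left inter_subset_left

theorem HTree.exists_splitSet_eq (T : HTree X) (hA : A ⊆ T.points) (hcard : 1 < #A) :
    ∃ l r : HTree X, .node l r ∈ T.subtrees ∧ A ⊆ l.points ∪ r.points ∧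
      ¬ A ⊆ l.points ∧ ¬ A ⊆ r.points ∧ T.splitSet A = (l.points ∩ A, r.points ∩ A) := by
  induction T with
  | leaf x => exact absurd (card_le_card hA) (by simpa [HTree.points] using hcard)
  | node l r hl hr =>
    rw [HTree.splitSet]
    split_ifs with h h'
    · obtain ⟨l', r', hmem, h⟩ := hl h
      exact ⟨l', r', Or.inr (Or.inl hmem), h⟩
    · obtain ⟨l', r', hmem, h⟩ := hr h'
      exact ⟨l', r', Or.inr (Or.inr hmem), h⟩
    · exact ⟨l, r, Or.inl rfl, hA, h, h', rfl⟩

theorem HTree.splitSet_nonempty (T : HTree X) (hA : A ⊆ T.points) (hcard : 1 < #A) :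
    (T.splitSet A).1.Nonempty ∧ (T.splitSet A).2.Nonempty := by
  obtain ⟨l, r, -, hlr, hl, hr, hsplit⟩ := T.exists_splitSet_eq hA hcard
  obtain ⟨x, hxA, hxr⟩ := not_subset.1 hr
  obtain ⟨y, hyA, hyl⟩ := not_subset.1 hl
  rw [hsplit]
  exact ⟨⟨x, mem_inter.2 ⟨(mem_union.1 (hlr hxA)).resolve_right hxr, hxA⟩⟩,
    ⟨y, mem_inter.2 ⟨(mem_union.1 (hlr hyA)).resolve_left hyl, hyA⟩⟩⟩

theorem HTree.IsProper.splitSet_of_subset (hT : T.IsProper) (hAD : A ⊆ D)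
    (h₁ : ¬ A ⊆ (T.splitSet D).1) (h₂ : ¬ A ⊆ (T.splitSet D).2) :
    T.splitSet A = ((T.splitSet D).1 ∩ A, (T.splitSet D).2 ∩ A) := by
  induction T with
  | leaf x => exact absurd hAD h₁
  | node l r hl hr =>
    rw [HTree.isProper_node] at hT
    simp only [HTree.splitSet] at h₁ h₂ ⊢
    by_cases hDl : D ⊆ l.points
    · rw [if_pos hDl] at h₁ h₂ ⊢
      rw [if_pos (hAD.trans hDl)]
      exact hl hT.2.1 h₁ h₂
    rw [if_neg hDl] at h₁ h₂ ⊢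
    by_cases hDr : D ⊆ r.points
    · rw [if_pos hDr] at h₁ h₂ ⊢
      obtain ⟨x, hxA, -⟩ := not_subset.1 h₁
      have hAl : ¬ A ⊆ l.points := fun h => disjoint_left.1 hT.1 (h hxA) (hDr (hAD hxA))
      rw [if_neg hAl, if_pos (hAD.trans hDr)]
      exact hr hT.2.2 h₁ h₂
    rw [if_neg hDr] at h₁ h₂ ⊢
    have hAl : ¬ A ⊆ l.points := fun h => h₁ (subset_inter h hAD)
    have hAr : ¬ A ⊆ r.points := fun h => h₂ (subset_inter h hAD)
    rw [if_neg hAl, if_neg hAr]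
    simp only [inter_assoc, inter_eq_right.2 hAD]

theorem HTree.IsProper.splitSet_union_of_subset (hT : T.IsProper) (hD : D ⊆ T.points)
    (hA : A.Nonempty) (hB : B.Nonempty) (hAD : A ⊆ (T.splitSet D).1)
    (hBD : B ⊆ (T.splitSet D).2) : T.splitSet (A ∪ B) = (A, B) := by
  have hdisj := hT.disjoint_splitSet D
  have hU := T.splitSet_union hD
  have hsub : A ∪ B ⊆ D := (union_subset_union hAD hBD).trans hU.subset
  rw [hT.splitSet_of_subset hsub, inter_union_distrib_left, inter_union_distrib_left,
    inter_eq_right.2 hAD, inter_eq_right.2 hBD,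
    disjoint_iff_inter_eq_empty.1 (hdisj.mono_right hBD),
    disjoint_iff_inter_eq_empty.1 (hdisj.symm.mono_right hAD), union_empty, empty_union]
  · exact fun h => hB.ne_empty (disjoint_self.1 (hdisj.mono (subset_union_right.trans h) hBD))
  · exact fun h => hA.ne_empty (disjoint_self.1 (hdisj.mono hAD (subset_union_left.trans h)))

end Tree

section Laminar

variable {X : Type*} [Fintype X] [DecidableEq X] {C : Clustering X} {T : HTree X}
  {A D N : Finset X}

/-- A set of points is laminar with respect to a clustering if it is disjoint from, contained in,
or contains each cluster. -/
def Laminar (C : Clustering X) (N : Finset X) : Prop :=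
  ∀ D ∈ C.parts, Disjoint N D ∨ N ⊆ D ∨ D ⊆ N

theorem laminar_singleton (C : Clustering X) (x : X) : Laminar C {x} := by
  intro D _
  by_cases hx : x ∈ D
  · exact .inr (.inl (singleton_subset_iff.2 hx))
  · exact .inl (disjoint_singleton_left.2 hx)

theorem Laminar.subset_of_mem (hN : Laminar C N) (hD : D ∈ C.parts) {x y : X} (hxN : x ∈ N)
    (hxD : x ∈ D) (hyD : y ∈ D) (hyN : y ∉ N) : N ⊆ D := by
  rcases hN D hD with h | h | h
  · exact absurd hxD (disjoint_left.1 h hxN)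
  · exact h
  · exact absurd (h hyD) hyN

/-- A proper tree of all points whose nodes are laminar with respect to the clustering `C`: the
property of average-linkage trees on which the analysis of the editing procedure rests. -/
structure IsLaminarTree (C : Clustering X) (T : HTree X) : Prop where
  points_eq : T.points = univ
  isProper : T.IsProper
  laminar : ∀ t ∈ T.subtrees, Laminar C t.points

theorem HTree.IsProper.disjoint_splitSet_or (hT : T.IsProper)
    (hlam : ∀ t ∈ T.subtrees, Laminar C t.points) (hA : A ⊆ T.points) (hcard : 1 < #A)
    (himpure : ∀ D ∈ C.parts, ¬ A ⊆ D) (hD : D ∈ C.parts) :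
    Disjoint (T.splitSet A).1 D ∨ Disjoint (T.splitSet A).2 D := by
  obtain ⟨l, r, hmem, hAlr, -, -, hsplit⟩ := T.exists_splitSet_eq hA hcard
  have hlr := hT l r hmem
  obtain ⟨hl, hr⟩ := T.children_mem_subtrees hmem
  rw [hsplit]
  by_contra! hcut
  obtain ⟨x, hx, hxD⟩ := not_disjoint_iff.1 hcut.1
  obtain ⟨y, hy, hyD⟩ := not_disjoint_iff.1 hcut.2
  have hxl := (mem_inter.1 hx).1
  have hyr := (mem_inter.1 hy).1
  have hlD : l.points ⊆ D :=
    (hlam l hl).subset_of_mem hD hxl hxD hyD (disjoint_right.1 hlr hyr)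
  have hrD : r.points ⊆ D :=
    (hlam r hr).subset_of_mem hD hyr hyD hxD (disjoint_left.1 hlr hxl)
  exact himpure D hD (hAlr.trans (union_subset hlD hrD))

end Laminar

section AverageLinkage

variable {X : Type*}

theorem avgSim_comm {S : X → X → ℝ} (hS : ∀ x y, S x y = S y x) (A B : Finset X) :
    avgSim S A B = avgSim S B A := by
  simp only [avgSim, sum_comm (s := A), mul_comm (#A : ℝ), hS]

theorem avgSim_le_iff (S : X → X → ℝ) {A B : Finset X} (hA : A.Nonempty) (hB : B.Nonempty)
    (m : ℝ) : avgSim S A B ≤ m ↔ ∑ y ∈ B, ∑ x ∈ A, S x y ≤ ∑ _y ∈ B, m * #A := by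
  have hpos : (0 : ℝ) < #A * #B := mod_cast mul_pos hA.card_pos hB.card_pos
  rw [avgSim, div_le_iff₀ hpos, sum_comm, sum_const, nsmul_eq_mul]
  ring_nf

variable [DecidableEq X]

theorem avgSim_le_of_finpartition {S : X → X → ℝ} {A B : Finset X} {m : ℝ} (hA : A.Nonempty)
    (hB : B.Nonempty) (P : Finpartition B) (h : ∀ N ∈ P.parts, avgSim S A N ≤ m) :
    avgSim S A B ≤ m := by
  rw [avgSim_le_iff S hA hB, ← P.biUnion_parts, sum_biUnion P.disjoint, sum_biUnion P.disjoint]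
  exact sum_le_sum fun N hN => (avgSim_le_iff S hA (P.nonempty_of_mem_parts hN) m).1 (h N hN)

variable [Fintype X] {S : X → X → ℝ} {C P : Clustering X} {A B D : Finset X}

theorem IsStable.avgSim_lt (hC : IsStable S C) (hD : D ∈ C.parts) (hA : A.Nonempty)
    (hAD : A ⊂ D) (hB : B.Nonempty) (hBD : Disjoint B D) :
    avgSim S A B < avgSim S A (D \ A) := by
  have hA' : (0 : ℝ) < #A := mod_cast hA.card_pos
  have hpoint : ∀ y ∈ B, ∑ x ∈ A, S x y < avgSim S A (D \ A) * #A := by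
    intro y hy
    obtain ⟨D', hD', hyD'⟩ := C.exists_mem (mem_univ y)
    have hne : D ≠ D' := by
      rintro rfl
      exact disjoint_left.1 hBD hy hyD'
    have hlt := hC D hD D' hD' hne A {y} hA hAD (singleton_nonempty y)
      (singleton_subset_iff.2 hyD')
    simpa [avgSim, div_lt_iff₀ hA'] using hlt
  rw [avgSim, div_lt_iff₀ (mul_pos hA' (mod_cast hB.card_pos)), sum_comm]
  calc ∑ y ∈ B, ∑ x ∈ A, S x y < ∑ _y ∈ B, avgSim S A (D \ A) * #A :=
        sum_lt_sum_of_nonempty hB hpoint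
    _ = avgSim S A (D \ A) * (#A * #B) := by rw [sum_const, nsmul_eq_mul]; ring

theorem IsStable.not_disjoint_of_forall_avgSim_le (hC : IsStable S C)
    (hlam : ∀ N ∈ P.parts, Laminar C N) (hA : A ∈ P.parts) (hB : B.Nonempty)
    (hmax : ∀ N ∈ P.parts, N ≠ A → avgSim S A N ≤ avgSim S A B) (hD : D ∈ C.parts)
    (hAD : A ⊂ D) : ¬ Disjoint B D := by
  intro hBD
  have hAne := P.nonempty_of_mem_parts hA
  have hsup : {N ∈ P.parts | N ⊆ D \ A}.sup id = D \ A := by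
    refine le_antisymm (Finset.sup_le fun N hN => (mem_filter.1 hN).2) fun y hy => ?_
    obtain ⟨hyD, hyA⟩ := mem_sdiff.1 hy
    obtain ⟨N, hN, hyN⟩ := P.exists_mem (mem_univ y)
    have hNA : Disjoint N A := P.disjoint hN hA (by rintro rfl; exact hyA hyN)
    obtain ⟨x, hxA⟩ := hAne
    have hND : N ⊆ D :=
      (hlam N hN).subset_of_mem hD hyN hyD (hAD.1 hxA) (disjoint_right.1 hNA hxA)
    exact mem_sup.2 ⟨N, mem_filter.2 ⟨hN, subset_sdiff.2 ⟨hND, hNA⟩⟩, hyN⟩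
  refine (hC.avgSim_lt hD hAne hAD hB hBD).not_ge ?_
  refine avgSim_le_of_finpartition hAne (sdiff_nonempty.2 hAD.2)
    (P.ofSubset (filter_subset _ _) hsup) fun N hN => ?_
  obtain ⟨hN, hNA⟩ := mem_filter.1 hN
  refine hmax N hN fun hNA' => ?_
  exact P.ne_empty hA (disjoint_self.1 (hNA' ▸ (subset_sdiff.1 hNA).2))

theorem IsStable.laminar_union (hS : ∀ x y, S x y = S y x) (hC : IsStable S C)
    (hlam : ∀ N ∈ P.parts, Laminar C N) (hA : A ∈ P.parts) (hB : B ∈ P.parts)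
    (hmaxA : ∀ N ∈ P.parts, N ≠ A → avgSim S A N ≤ avgSim S A B)
    (hmaxB : ∀ N ∈ P.parts, N ≠ B → avgSim S B N ≤ avgSim S A B) : Laminar C (A ∪ B) := by
  rw [avgSim_comm hS A] at hmaxB
  have hAne := P.nonempty_of_mem_parts hA
  have hBne := P.nonempty_of_mem_parts hB
  intro D hD
  by_cases hDA : D ⊆ A
  · exact .inr (.inr (hDA.trans subset_union_left))
  by_cases hDB : D ⊆ B
  · exact .inr (.inr (hDB.trans subset_union_right))
  rcases hlam A hA D hD with hAD | hAD | hAD <;> rcases hlam B hB D hD with hBD | hBD | hBD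
  · exact .inl (disjoint_union_left.2 ⟨hAD, hBD⟩)
  · exact absurd hAD (hC.not_disjoint_of_forall_avgSim_le hlam hB hAne hmaxB hD ⟨hBD, hDB⟩)
  · exact absurd hBD hDB
  · exact absurd hBD (hC.not_disjoint_of_forall_avgSim_le hlam hA hBne hmaxA hD ⟨hAD, hDA⟩)
  · exact .inr (.inl (union_subset hAD hBD))
  all_goals contradiction

/-- The invariant of average linkage: the trees of the forest are proper and laminar with respect
to the clustering `C`, and their point sets partition `X`. -/
structure IsLaminarForest (C : Clustering X) (F : Multiset (HTree X)) : Prop where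
  exists_clustering : ∃ P : Clustering X, F.map HTree.points = P.parts.val
  isProper : ∀ t ∈ F, t.IsProper
  laminar : ∀ t ∈ F, ∀ u ∈ t.subtrees, Laminar C u.points

theorem isLaminarForest_leaves (C : Clustering X) :
    IsLaminarForest C ((univ : Finset X).val.map HTree.leaf) where
  exists_clustering := ⟨⊥, by simp [Finpartition.parts_bot, HTree.points, Function.comp_def]⟩
  isProper t ht := by
    obtain ⟨x, -, rfl⟩ := Multiset.mem_map.1 ht
    exact HTree.isProper_leaf x
  laminar t ht u hu := by
    obtain ⟨x, -, rfl⟩ := Multiset.mem_map.1 ht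
    rw [Set.mem_singleton_iff.1 hu]
    exact laminar_singleton C x

theorem IsLaminarForest.join {N₁ N₂ : HTree X} {R : Multiset (HTree X)}
    (hF : IsLaminarForest C (N₁ ::ₘ N₂ ::ₘ R)) (hlam : Laminar C (N₁.points ∪ N₂.points)) :
    IsLaminarForest C (.node N₁ N₂ ::ₘ R) := by
  obtain ⟨P, hP⟩ := hF.exists_clustering
  simp only [Multiset.map_cons] at hP
  have hnodup := hP ▸ P.parts.nodup
  have hne : N₁.points ≠ N₂.points := by
    intro h
    simp [h] at hnodup
  have hval : ({N₁.points, N₂.points} : Finset (Finset X)).val = {N₁.points, N₂.points} :=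
    insert_val_of_notMem (by simpa using hne)
  have hM : {N₁.points, N₂.points} ⊆ P.parts := by
    simp [insert_subset_iff, ← mem_val, ← hP]
  have hdisj : Disjoint N₁.points N₂.points :=
    P.disjoint (hM (mem_insert_self _ _)) (hM (by simp)) hne
  refine ⟨⟨exchange P hM (.indiscrete ?_), ?_⟩, fun t ht => ?_, fun t ht u hu => ?_⟩
  · simpa using fun h => absurd h N₁.points_nonempty.ne_empty
  · rw [exchange_parts_val, ← hP, hval]
    simp [HTree.points]
  · rcases Multiset.mem_cons.1 ht with rfl | ht
    · exact HTree.isProper_node.2 ⟨hdisj, hF.isProper _ (by simp), hF.isProper _ (by simp)⟩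
    · exact hF.isProper t (by simp [ht])
  · rcases Multiset.mem_cons.1 ht with rfl | ht
    · rcases hu with rfl | hu | hu
      · exact hlam
      · exact hF.laminar N₁ (by simp) u hu
      · exact hF.laminar N₂ (by simp) u hu
    · exact hF.laminar t (by simp [ht]) u hu

theorem IsLaminarForest.step (hS : ∀ x y, S x y = S y x) (hC : IsStable S C)
    {F F' : Multiset (HTree X)} (hF : IsLaminarForest C F) (hstep : AvgLinkageStep S F F') :
    IsLaminarForest C F' := by
  obtain ⟨N₁, N₂, R, rfl, hmax, rfl⟩ := hstep
  obtain ⟨P, hP⟩ := hF.exists_clustering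
  have hmem : ∀ N, N ∈ P.parts ↔ ∃ t ∈ N₁ ::ₘ N₂ ::ₘ R, t.points = N := fun N => by
    rw [← mem_val, ← hP, Multiset.mem_map]
  have hlam : ∀ N ∈ P.parts, Laminar C N := fun N hN => by
    obtain ⟨t, ht, rfl⟩ := (hmem N).1 hN
    exact hF.laminar t ht t t.mem_subtrees_self
  refine hF.join (hC.laminar_union hS hlam ((hmem _).2 ⟨N₁, by simp, rfl⟩)
    ((hmem _).2 ⟨N₂, by simp, rfl⟩) (fun N hN hne => ?_) fun N hN hne => ?_)
  · obtain ⟨t, ht, rfl⟩ := (hmem N).1 hN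
    obtain ⟨R', hR'⟩ := Multiset.exists_cons_of_mem
      ((Multiset.mem_cons.1 ht).resolve_left (by rintro rfl; exact hne rfl))
    exact hmax N₁ t R' (by rw [hR'])
  · rw [Multiset.cons_swap] at hmem hmax
    obtain ⟨t, ht, rfl⟩ := (hmem N).1 hN
    obtain ⟨R', hR'⟩ := Multiset.exists_cons_of_mem
      ((Multiset.mem_cons.1 ht).resolve_left (by rintro rfl; exact hne rfl))
    exact hmax N₂ t R' (by rw [hR'])

theorem IsStable.isLaminarTree (hS : ∀ x y, S x y = S y x) (hC : IsStable S C) {T : HTree X}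
    (hT : IsAvgLinkageTree S T) : IsLaminarTree C T := by
  have hinv : ∀ F, Relation.ReflTransGen (AvgLinkageStep S)
      ((univ : Finset X).val.map HTree.leaf) F → IsLaminarForest C F := by
    intro F hF
    induction hF with
    | refl => exact isLaminarForest_leaves C
    | tail _ hstep ih => exact ih.step hS hC hstep
  have hF := hinv {T} hT
  refine ⟨?_, hF.isProper T (by simp), hF.laminar T (by simp)⟩
  obtain ⟨P, hP⟩ := hF.exists_clustering
  have hparts : P.parts = {T.points} := val_injective (by rw [← hP]; simp)
  rw [← P.sup_parts, hparts, sup_singleton, id]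

end AverageLinkage

section MeetCount

variable {α : Type*} [DecidableEq α] {F : Finset (Finset α)} {s A B D : Finset α}
  {P Q : Finpartition s}

/-- The number of members of the family `F` that have a point in common with `A`. -/
def meetCount (F : Finset (Finset α)) (A : Finset α) : ℕ :=
  #{D ∈ F | ¬ Disjoint A D}

theorem meetCount_mono (F : Finset (Finset α)) (h : A ⊆ B) : meetCount F A ≤ meetCount F B :=
  card_le_card (monotone_filter_right F fun _ _ hA hB => hA (hB.mono_left h))

theorem meetCount_union_add (F : Finset (Finset α)) (A B : Finset α) :
    meetCount F (A ∪ B) + #{D ∈ F | ¬ Disjoint A D ∧ ¬ Disjoint B D} =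
      meetCount F A + meetCount F B := by
  simp only [meetCount, disjoint_union_left, not_and_or, filter_or, filter_and,
    card_union_add_card_inter]

theorem meetCount_union_le (F : Finset (Finset α)) (A B : Finset α) :
    meetCount F (A ∪ B) ≤ meetCount F A + meetCount F B :=
  (meetCount_union_add F A B).le.trans' (Nat.le_add_right _ _)

theorem meetCount_union_lt (hD : D ∈ F) (hA : ¬ Disjoint A D) (hB : ¬ Disjoint B D) :
    meetCount F (A ∪ B) < meetCount F A + meetCount F B := by
  rw [← meetCount_union_add]
  exact Nat.lt_add_of_pos_right (card_pos.2 ⟨D, mem_filter.2 ⟨hD, hA, hB⟩⟩)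

theorem meetCount_union_of_forall_disjoint (h : ∀ D ∈ F, Disjoint A D ∨ Disjoint B D) :
    meetCount F (A ∪ B) = meetCount F A + meetCount F B := by
  rw [← meetCount_union_add, filter_false_of_mem fun D hD => by simpa [imp_iff_not_or] using h D hD,
    card_empty, add_zero]

theorem sum_meetCount_comm (F G : Finset (Finset α)) :
    ∑ A ∈ F, meetCount G A = ∑ D ∈ G, meetCount F D := by
  simp only [meetCount, card_filter]
  rw [sum_comm]
  exact sum_congr rfl fun D _ => sum_congr rfl fun A _ =>
    if_congr (not_congr disjoint_comm) rfl rfl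

theorem meetCount_parts_pos (hA : A.Nonempty) (hAs : A ⊆ s) : 0 < meetCount P.parts A := by
  obtain ⟨x, hx⟩ := hA
  obtain ⟨D, hD, hxD⟩ := P.exists_mem (hAs hx)
  exact card_pos.2 ⟨D, mem_filter.2 ⟨hD, not_disjoint_iff.2 ⟨x, hx, hxD⟩⟩⟩

theorem meetCount_parts_of_subset (hD : D ∈ P.parts) (hA : A.Nonempty) (hAD : A ⊆ D) :
    meetCount P.parts A = 1 := by
  refine card_eq_one.2 ⟨D, ext fun E => ?_⟩
  obtain ⟨x, hx⟩ := hA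
  rw [mem_filter, mem_singleton]
  refine ⟨fun ⟨hE, hAE⟩ => ?_, ?_⟩
  · obtain ⟨y, hy, hyE⟩ := not_disjoint_iff.1 hAE
    exact P.eq_of_mem_parts hE hD hyE (hAD hy)
  · rintro rfl
    exact ⟨hD, not_disjoint_iff.2 ⟨x, hx, hAD hx⟩⟩

theorem exists_subset_of_meetCount_le_one (hA : A.Nonempty) (hAs : A ⊆ s)
    (h : meetCount P.parts A ≤ 1) : ∃ D ∈ P.parts, A ⊆ D := by
  obtain ⟨x, hx⟩ := hA
  obtain ⟨D, hD, hxD⟩ := P.exists_mem (hAs hx)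
  refine ⟨D, hD, fun y hy => ?_⟩
  obtain ⟨E, hE, hyE⟩ := P.exists_mem (hAs hy)
  have hED : E = D := card_le_one.1 h E (mem_filter.2 ⟨hE, not_disjoint_iff.2 ⟨y, hy, hyE⟩⟩)
    D (mem_filter.2 ⟨hD, not_disjoint_iff.2 ⟨x, hx, hxD⟩⟩)
  exact hED ▸ hyE

theorem card_parts_le_sum_meetCount (P Q : Finpartition s) :
    #P.parts ≤ ∑ A ∈ P.parts, meetCount Q.parts A := by
  rw [card_eq_sum_ones]
  exact sum_le_sum fun A hA => meetCount_parts_pos (P.nonempty_of_mem_parts hA) (P.subset hA)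

theorem sum_meetCount_of_le (h : Q ≤ P) : ∑ D ∈ P.parts, meetCount Q.parts D = #Q.parts := by
  rw [sum_meetCount_comm, card_eq_sum_ones]
  refine sum_congr rfl fun A hA => ?_
  obtain ⟨D, hD, hAD⟩ := h hA
  exact meetCount_parts_of_subset hD (Q.nonempty_of_mem_parts hA) hAD

end MeetCount

section Potential

variable {α : Type*} [DecidableEq α] {s A B D : Finset α} {M : Finset (Finset α)}
  {P H C : Finpartition s}

/-- The contribution of a cluster `A` to the potential: `P` is the target partition and `H` the
refinement of `P` into the two parts into which the tree splits each target cluster. -/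
def weight (P H : Finpartition s) (A : Finset α) : ℤ :=
  2 * meetCount P.parts A + meetCount H.parts A - 1

/-- The potential of the partition `C`, normalized to vanish at the target `P`. -/
def potential (P H C : Finpartition s) : ℤ :=
  ∑ A ∈ C.parts, weight P H A - ∑ D ∈ P.parts, weight P H D

/-- The number of edits that lead from `C` to `P` by splitting target clusters off the clusters
of `C` and merging the pieces of each target cluster. -/
def correctionCost (P C : Finpartition s) : ℤ :=
  ∑ A ∈ C.parts, ((meetCount P.parts A : ℤ) - 1) + ∑ D ∈ P.parts, ((meetCount C.parts D : ℤ) - 1)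

theorem weight_union_of_forall_disjoint (hHP : H ≤ P)
    (h : ∀ D ∈ P.parts, Disjoint A D ∨ Disjoint B D) :
    weight P H A + weight P H B = weight P H (A ∪ B) - 1 := by
  have hH : ∀ E ∈ H.parts, Disjoint A E ∨ Disjoint B E := fun E hE => by
    obtain ⟨D, hD, hED⟩ := hHP hE
    exact (h D hD).imp (·.mono_right hED) (·.mono_right hED)
  simp only [weight, meetCount_union_of_forall_disjoint h, meetCount_union_of_forall_disjoint hH]
  push_cast
  ring

theorem weight_union_lt (hD : D ∈ P.parts) (hA : ¬ Disjoint A D) (hB : ¬ Disjoint B D) :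
    weight P H (A ∪ B) < weight P H A + weight P H B := by
  have hP := meetCount_union_lt hD hA hB
  have hH := meetCount_union_le H.parts A B
  simp only [weight]
  lia

theorem two_le_weight (hA : A.Nonempty) (hAs : A ⊆ s) : 2 ≤ weight P H A := by
  have hP := meetCount_parts_pos (P := P) hA hAs
  have hH := meetCount_parts_pos (P := H) hA hAs
  simp only [weight]
  lia

theorem weight_of_subset (hHP : H ≤ P) {E : Finset α} (hE : E ∈ H.parts) (hA : A.Nonempty)
    (hAE : A ⊆ E) : weight P H A = 2 := by
  obtain ⟨D, hD, hED⟩ := hHP hE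
  rw [weight, meetCount_parts_of_subset hE hA hAE,
    meetCount_parts_of_subset hD hA (hAE.trans hED)]
  norm_num

theorem exists_subset_of_weight_le_two (hA : A.Nonempty) (hAs : A ⊆ s) (h : weight P H A ≤ 2) :
    ∃ E ∈ H.parts, A ⊆ E := by
  have hP := meetCount_parts_pos (P := P) hA hAs
  refine exists_subset_of_meetCount_le_one hA hAs ?_
  simp only [weight] at h
  lia

theorem potential_eq (hHP : H ≤ P) (C : Finpartition s) :
    potential P H C = 2 * ∑ D ∈ P.parts, (meetCount C.parts D : ℤ) +
      ∑ E ∈ H.parts, (meetCount C.parts E : ℤ) - #C.parts - #P.parts - #H.parts := by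
  have hPC : (∑ A ∈ C.parts, meetCount P.parts A : ℤ) =
      ∑ D ∈ P.parts, (meetCount C.parts D : ℤ) :=
    mod_cast sum_meetCount_comm _ _
  have hHC : (∑ A ∈ C.parts, meetCount H.parts A : ℤ) =
      ∑ E ∈ H.parts, (meetCount C.parts E : ℤ) :=
    mod_cast sum_meetCount_comm _ _
  have hPP : (∑ D ∈ P.parts, meetCount P.parts D : ℤ) = #P.parts :=
    mod_cast sum_meetCount_of_le le_rfl
  have hHP' : (∑ D ∈ P.parts, meetCount H.parts D : ℤ) = #H.parts :=
    mod_cast sum_meetCount_of_le hHP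
  simp only [potential, weight, sum_sub_distrib, sum_add_distrib, ← mul_sum, sum_const,
    hPC, hHC, hPP, hHP', nsmul_eq_mul, mul_one]
  ring

theorem sum_meetCount_sub_one_le_potential (hHP : H ≤ P) (C : Finpartition s) :
    ∑ D ∈ P.parts, ((meetCount C.parts D : ℤ) - 1) ≤ potential P H C := by
  have hC : (#C.parts : ℤ) ≤ ∑ D ∈ P.parts, (meetCount C.parts D : ℤ) :=
    mod_cast sum_meetCount_comm C.parts P.parts ▸ card_parts_le_sum_meetCount C P
  have hH : (#H.parts : ℤ) ≤ ∑ E ∈ H.parts, (meetCount C.parts E : ℤ) :=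
    mod_cast card_parts_le_sum_meetCount H C
  rw [potential_eq hHP, sum_sub_distrib, sum_const, nsmul_one]
  lia

theorem zero_le_meetCount_sub_one (hD : D ∈ P.parts) : 0 ≤ (meetCount C.parts D : ℤ) - 1 := by
  have := meetCount_parts_pos (P := C) (P.nonempty_of_mem_parts hD) (P.subset hD)
  lia

theorem potential_nonneg (hHP : H ≤ P) (C : Finpartition s) : 0 ≤ potential P H C :=
  (sum_nonneg fun _ hD => zero_le_meetCount_sub_one hD).trans
    (sum_meetCount_sub_one_le_potential hHP C)

theorem meetCount_le_potential_add_one (hHP : H ≤ P) (C : Finpartition s) (hD : D ∈ P.parts) :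
    (meetCount C.parts D : ℤ) ≤ potential P H C + 1 := by
  have hle := single_le_sum (f := fun D => (meetCount C.parts D : ℤ) - 1)
    (fun D hD => zero_le_meetCount_sub_one hD) hD
  linarith [sum_meetCount_sub_one_le_potential hHP C]

/-- A part of `H` meets at most as many clusters as the target cluster that contains it, and every
target cluster contains at most two parts of `H`. -/
theorem sum_meetCount_sub_one_le_two_mul (hHP : H ≤ P)
    (htwo : ∀ D ∈ P.parts, meetCount H.parts D ≤ 2) (C : Finpartition s) :
    ∑ E ∈ H.parts, ((meetCount C.parts E : ℤ) - 1) ≤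
      2 * ∑ D ∈ P.parts, ((meetCount C.parts D : ℤ) - 1) := by
  calc ∑ E ∈ H.parts, ((meetCount C.parts E : ℤ) - 1)
      ≤ ∑ E ∈ H.parts, ∑ D ∈ P.parts with ¬ Disjoint D E, ((meetCount C.parts D : ℤ) - 1) := by
        refine sum_le_sum fun E hE => ?_
        obtain ⟨D, hD, hED⟩ := hHP hE
        have hmem : D ∈ P.parts.filter (¬ Disjoint · E) := by
          refine mem_filter.2 ⟨hD, fun hDE => H.ne_empty hE ?_⟩
          exact disjoint_self.1 (hDE.mono_left hED)
        refine le_trans ?_ (single_le_sum (fun D hD => ?_) hmem)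
        · exact sub_le_sub_right (mod_cast meetCount_mono C.parts hED) 1
        · exact zero_le_meetCount_sub_one (mem_filter.1 hD).1
    _ = ∑ D ∈ P.parts, meetCount H.parts D * ((meetCount C.parts D : ℤ) - 1) := by
        rw [sum_comm' (t' := P.parts) (s' := fun D => H.parts.filter (¬ Disjoint D ·))
          (by simp; tauto)]
        simp only [sum_const, nsmul_eq_mul, meetCount]
    _ ≤ 2 * ∑ D ∈ P.parts, ((meetCount C.parts D : ℤ) - 1) := by
        rw [mul_sum]
        exact sum_le_sum fun D hD => mul_le_mul_of_nonneg_right (mod_cast htwo D hD)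
          (zero_le_meetCount_sub_one hD)

theorem potential_exchange (C : Finpartition s) (hM : M ⊆ C.parts) (Q : Finpartition (M.sup id)) :
    potential P H (exchange C hM Q) =
      potential P H C - ∑ A ∈ M, weight P H A + ∑ N ∈ Q.parts, weight P H N := by
  rw [potential, potential, sum_exchange]
  ring

theorem correctionCost_eq (P C : Finpartition s) :
    correctionCost P C = ∑ A ∈ C.parts, (2 * (meetCount P.parts A : ℤ) - 1) - #P.parts := by
  have hPC : (∑ D ∈ P.parts, meetCount C.parts D : ℤ) =
      ∑ A ∈ C.parts, (meetCount P.parts A : ℤ) :=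
    mod_cast sum_meetCount_comm _ _
  simp only [correctionCost, sum_sub_distrib, hPC, ← mul_sum, sum_const, nsmul_one]
  ring

theorem correctionCost_exchange (C : Finpartition s) (hM : M ⊆ C.parts)
    (Q : Finpartition (M.sup id)) :
    correctionCost P (exchange C hM Q) = correctionCost P C -
      ∑ A ∈ M, (2 * (meetCount P.parts A : ℤ) - 1) +
      ∑ N ∈ Q.parts, (2 * (meetCount P.parts N : ℤ) - 1) := by
  rw [correctionCost_eq, correctionCost_eq, sum_exchange]
  ring

theorem correctionCost_self (P : Finpartition s) : correctionCost P P = 0 := by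
  have hone : ∀ D ∈ P.parts, (meetCount P.parts D : ℤ) - 1 = 0 := fun D hD => by
    simp [meetCount_parts_of_subset hD (P.nonempty_of_mem_parts hD) subset_rfl]
  rw [correctionCost, sum_eq_zero hone, add_zero]

theorem potential_le_three_mul_correctionCost (hHP : H ≤ P)
    (htwo : ∀ D ∈ P.parts, meetCount H.parts D ≤ 2) (C : Finpartition s) :
    potential P H C ≤ 3 * correctionCost P C := by
  have hH := sum_meetCount_sub_one_le_two_mul hHP htwo C
  have hC : (0 : ℤ) ≤ ∑ A ∈ C.parts, ((meetCount P.parts A : ℤ) - 1) :=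
    sum_nonneg fun A hA => zero_le_meetCount_sub_one hA
  have hPC : (∑ A ∈ C.parts, meetCount P.parts A : ℤ) =
      ∑ D ∈ P.parts, (meetCount C.parts D : ℤ) :=
    mod_cast sum_meetCount_comm _ _
  rw [potential_eq hHP, correctionCost]
  simp only [sum_sub_distrib, sum_const, nsmul_one, hPC] at hH hC ⊢
  linarith

theorem exists_improvement (hne : C ≠ P) :
    (∃ A ∈ C.parts, ∃ D ∈ P.parts, (A ∩ D).Nonempty ∧ (A \ D).Nonempty) ∨
      ∃ A ∈ C.parts, ∃ B ∈ C.parts, A ≠ B ∧ ∃ D ∈ P.parts, A ⊆ D ∧ B ⊆ D := by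
  by_contra! ⟨hpure, hdistinct⟩
  have hsub : ∀ A ∈ C.parts, ∀ D ∈ P.parts, ∀ x ∈ A, x ∈ D → A ⊆ D := fun A hA D hD x hx hxD =>
    sdiff_eq_empty_iff_subset.1 (hpure A hA D hD ⟨x, mem_inter.2 ⟨hx, hxD⟩⟩)
  have hCP : C.parts ⊆ P.parts := fun A hA => by
    obtain ⟨x, hx⟩ := C.nonempty_of_mem_parts hA
    obtain ⟨D, hD, hxD⟩ := P.exists_mem (C.subset hA hx)
    have hAD := hsub A hA D hD x hx hxD
    suffices D ⊆ A from hAD.antisymm this ▸ hD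
    intro y hy
    obtain ⟨B, hB, hyB⟩ := C.exists_mem (P.subset hD hy)
    by_contra hyA
    exact hdistinct A hA B hB (fun h => hyA (h ▸ hyB)) D hD hAD (hsub B hB D hD y hyB hy)
  refine hne (Finpartition.ext (hCP.antisymm fun D hD => ?_))
  obtain ⟨x, hx⟩ := P.nonempty_of_mem_parts hD
  obtain ⟨A, hA, hxA⟩ := C.exists_mem (P.subset hD hx)
  rwa [← P.eq_of_mem_parts (hCP hA) hD hxA hx]

end Potential

section Response

variable {X : Type*} [Fintype X] [DecidableEq X] {P C : Clustering X} {T : HTree X}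
  {A B D E N U : Finset X} {M : Finset (Finset X)}

namespace IsLaminarTree

theorem subset_points (hT : IsLaminarTree P T) (A : Finset X) : A ⊆ T.points :=
  hT.points_eq ▸ subset_univ A

/-- `Split(U)`, as a partition of `U`; a set with at most one point is not split. -/
def split (hT : IsLaminarTree P T) (U : Finset X) : Finpartition U :=
  pairPartition (hT.isProper.disjoint_splitSet U) (T.splitSet_union (hT.subset_points U))

theorem mem_split (hT : IsLaminarTree P T) :
    N ∈ (hT.split U).parts ↔ N.Nonempty ∧ (N = (T.splitSet U).1 ∨ N = (T.splitSet U).2) :=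
  mem_pairPartition

theorem split_parts (hT : IsLaminarTree P T) (hU : 1 < #U) :
    (hT.split U).parts = {(T.splitSet U).1, (T.splitSet U).2} :=
  have h := T.splitSet_nonempty (hT.subset_points U) hU
  pairPartition_parts h.1 h.2

theorem sum_split (hT : IsLaminarTree P T) (hU : 1 < #U) (w : Finset X → ℤ) :
    ∑ N ∈ (hT.split U).parts, w N = w (T.splitSet U).1 + w (T.splitSet U).2 := by
  have hne := (T.splitSet_nonempty (hT.subset_points U) hU).1.ne_empty
  rw [hT.split_parts hU, sum_pair ((hT.isProper.disjoint_splitSet U).ne hne)]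

/-- The refinement of the target clustering `P` into the parts of the sets `Split(D)` of its
clusters `D`. -/
def halves (hT : IsLaminarTree P T) : Clustering X :=
  P.bind fun D _ => hT.split D

theorem mem_halves (hT : IsLaminarTree P T) :
    E ∈ hT.halves.parts ↔ ∃ D ∈ P.parts, E ∈ (hT.split D).parts := by
  simp [halves]

theorem halves_le (hT : IsLaminarTree P T) : hT.halves ≤ P := by
  intro E hE
  obtain ⟨D, hD, hED⟩ := hT.mem_halves.1 hE
  exact ⟨D, hD, (hT.split D).le hED⟩

theorem mem_split_of_mem_halves (hT : IsLaminarTree P T) (hD : D ∈ P.parts)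
    (hE : E ∈ hT.halves.parts) (hDE : ¬ Disjoint D E) : E ∈ (hT.split D).parts := by
  obtain ⟨D', hD', hED'⟩ := hT.mem_halves.1 hE
  obtain ⟨x, hxD, hxE⟩ := not_disjoint_iff.1 hDE
  rwa [P.eq_of_mem_parts hD hD' hxD ((hT.split D').le hED' hxE)]

theorem meetCount_halves_le_two (hT : IsLaminarTree P T) (hD : D ∈ P.parts) :
    meetCount hT.halves.parts D ≤ 2 := by
  refine le_trans (card_le_card fun E hE => ?_)
    (card_le_two (a := (T.splitSet D).1) (b := (T.splitSet D).2))
  obtain ⟨hE, hDE⟩ := mem_filter.1 hE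
  simpa using (hT.mem_split.1 (hT.mem_split_of_mem_halves hD hE hDE)).2

theorem sdiff_half_nonempty (hT : IsLaminarTree P T) (hD : D ∈ P.parts) (hcard : 1 < #D)
    (hE : E ∈ hT.halves.parts) : (D \ E).Nonempty := by
  refine sdiff_nonempty.2 fun hDE => ?_
  have hDE' : ¬ Disjoint D E := fun h => P.ne_empty hD (disjoint_self.1 (h.mono_right hDE))
  have hne := T.splitSet_nonempty (hT.subset_points D) hcard
  have hsub : ∀ N ∈ (hT.split D).parts, ¬ Disjoint N E := fun N hN h =>
    (hT.split D).ne_empty hN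
      (disjoint_self.1 (h.mono_right (((hT.split D).le hN).trans hDE)))
  have hunique : ∀ N ∈ (hT.split D).parts, N = E := fun N hN => by
    by_contra hNE
    exact hsub N hN ((hT.split D).disjoint hN (hT.mem_split_of_mem_halves hD hE hDE') hNE)
  refine (hT.isProper.disjoint_splitSet D).ne hne.1.ne_empty ?_
  rw [hunique _ (hT.mem_split.2 ⟨hne.1, .inl rfl⟩), hunique _ (hT.mem_split.2 ⟨hne.2, .inr rfl⟩)]

theorem exists_half_of_mem_split (hT : IsLaminarTree P T) (hD : D ∈ P.parts) (hUD : U ⊆ D)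
    (hN : N ∈ (hT.split U).parts) : ∃ E ∈ hT.halves.parts, N ⊆ E := by
  have hNU := (hT.split U).le hN
  suffices h : N ⊆ (T.splitSet D).1 ∨ N ⊆ (T.splitSet D).2 by
    have hNne := (hT.split U).nonempty_of_mem_parts hN
    rcases h with h | h
    · exact ⟨_, hT.mem_halves.2 ⟨D, hD, hT.mem_split.2 ⟨hNne.mono h, .inl rfl⟩⟩, h⟩
    · exact ⟨_, hT.mem_halves.2 ⟨D, hD, hT.mem_split.2 ⟨hNne.mono h, .inr rfl⟩⟩, h⟩
  by_cases h₁ : U ⊆ (T.splitSet D).1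
  · exact .inl (hNU.trans h₁)
  by_cases h₂ : U ⊆ (T.splitSet D).2
  · exact .inr (hNU.trans h₂)
  have hsplit := (hT.mem_split.1 hN).2
  rw [hT.isProper.splitSet_of_subset hUD h₁ h₂] at hsplit
  exact hsplit.imp (fun h => h.subset.trans inter_subset_left)
    fun h => h.subset.trans inter_subset_left

theorem sum_weight_split_of_subset (hT : IsLaminarTree P T) (hU : 1 < #U) (hD : D ∈ P.parts)
    (hUD : U ⊆ D) : ∑ N ∈ (hT.split U).parts, weight P hT.halves N = 4 := by
  have hweight : ∀ N ∈ (hT.split U).parts, weight P hT.halves N = 2 := fun N hN => by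
    obtain ⟨E, hE, hNE⟩ := hT.exists_half_of_mem_split hD hUD hN
    exact weight_of_subset hT.halves_le hE ((hT.split U).nonempty_of_mem_parts hN) hNE
  rw [hT.split_parts hU] at hweight
  rw [hT.sum_split hU, hweight _ (by simp), hweight _ (by simp)]
  norm_num

theorem sum_weight_split_of_forall_not_subset (hT : IsLaminarTree P T) (hU : 1 < #U)
    (himpure : ∀ D ∈ P.parts, ¬ U ⊆ D) :
    ∑ N ∈ (hT.split U).parts, weight P hT.halves N = weight P hT.halves U - 1 := by
  rw [hT.sum_split hU, weight_union_of_forall_disjoint hT.halves_le fun D hD =>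
    hT.isProper.disjoint_splitSet_or hT.laminar (hT.subset_points U) hU himpure hD,
    T.splitSet_union (hT.subset_points U)]

end IsLaminarTree

theorem FeasibleSplit.not_subset (h : FeasibleSplit P C.parts A) : ∀ D ∈ P.parts, ¬ A ⊆ D := by
  obtain ⟨-, D₁, hD₁, D₂, hD₂, hne, ⟨x, hx⟩, ⟨y, hy⟩⟩ := h
  rw [mem_inter] at hx hy
  intro D hD hAD
  exact hne ((P.eq_of_mem_parts hD₁ hD hx.2 (hAD hx.1)).trans
    (P.eq_of_mem_parts hD hD₂ (hAD hy.1) hy.2))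

theorem FeasibleSplit.one_lt_card (h : FeasibleSplit P C.parts A) : 1 < #A := by
  obtain ⟨-, D₁, hD₁, D₂, hD₂, hne, ⟨x, hx⟩, ⟨y, hy⟩⟩ := h
  rw [mem_inter] at hx hy
  refine Finset.one_lt_card.2 ⟨x, hx.1, y, hy.1, ?_⟩
  rintro rfl
  exact hne (P.eq_of_mem_parts hD₁ hD₂ hx.2 hy.2)

theorem IsLaminarTree.exists_potential_lt_of_feasibleSplit (hT : IsLaminarTree P T)
    (hA : FeasibleSplit P C.parts A) :
    ∃ C' : Clustering X, C'.parts = splitProc T C.parts A ∧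
      potential P hT.halves C' < potential P hT.halves C := by
  refine ⟨exchange C (singleton_subset_iff.2 hA.1)
    ((hT.split A).copy (sup_singleton (f := id)).symm), ?_, ?_⟩
  · rw [exchange_parts, Finpartition.copy_parts, hT.split_parts hA.one_lt_card, splitProc,
      sdiff_singleton_eq_erase]
  · rw [potential_exchange, Finpartition.copy_parts, sum_singleton,
      hT.sum_weight_split_of_forall_not_subset hA.one_lt_card hA.not_subset]
    linarith

/-- A pair of clusters is internal if both lie in the same part of the refinement `H` of the
target clustering. These are the only merges that need not decrease the potential. -/
def IsInternal (H : Clustering X) (M : Finset (Finset X)) : Prop :=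
  ∃ E ∈ H.parts, ∀ A ∈ M, A ⊆ E

theorem FeasibleMerge.one_lt_card_sup (h : FeasibleMerge P C.parts M) : 1 < #(M.sup id) := by
  obtain ⟨hMC, hcard, -⟩ := h
  obtain ⟨A, B, hAB, rfl⟩ := card_eq_two.1 hcard
  have hA : A ∈ C.parts := hMC (by simp)
  have hB : B ∈ C.parts := hMC (by simp)
  have hdisj : Disjoint A B := C.disjoint hA hB hAB
  have hApos := (C.nonempty_of_mem_parts hA).card_pos
  have hBpos := (C.nonempty_of_mem_parts hB).card_pos
  simp only [sup_insert, sup_singleton, id, sup_eq_union, card_union_of_disjoint hdisj]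
  lia

theorem FeasibleMerge.weight_sup_lt {H : Clustering X} (h : FeasibleMerge P C.parts M) :
    weight P H (M.sup id) < ∑ A ∈ M, weight P H A := by
  obtain ⟨-, hcard, D, hD, hMD⟩ := h
  obtain ⟨A, B, hAB, rfl⟩ := card_eq_two.1 hcard
  simp only [sup_insert, sup_singleton, id, sup_eq_union, sum_pair hAB]
  exact weight_union_lt hD (not_disjoint_iff_nonempty_inter.2 (hMD A (by simp)))
    (not_disjoint_iff_nonempty_inter.2 (hMD B (by simp)))

theorem FeasibleMerge.four_le_sum_weight {H : Clustering X} (h : FeasibleMerge P C.parts M) :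
    4 ≤ ∑ A ∈ M, weight P H A :=
  calc (4 : ℤ) = ∑ _A ∈ M, 2 := by rw [sum_const, h.2.1]; norm_num
    _ ≤ ∑ A ∈ M, weight P H A := sum_le_sum fun _ hA =>
        two_le_weight (C.nonempty_of_mem_parts (h.1 hA)) (subset_univ _)

theorem IsLaminarTree.splitSet_union_pair (hT : IsLaminarTree P T) (hA : A.Nonempty)
    (hB : B.Nonempty) (hD : D ∈ P.parts) (hAD : A ⊆ D) (hBD : B ⊆ D)
    (hA₂ : weight P hT.halves A ≤ 2) (hB₂ : weight P hT.halves B ≤ 2)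
    (hext : ¬ IsInternal hT.halves {A, B}) :
    ({(T.splitSet (A ∪ B)).1, (T.splitSet (A ∪ B)).2} : Finset (Finset X)) = {A, B} := by
  have half_eq : ∀ N : Finset X, N.Nonempty → N ⊆ D → weight P hT.halves N ≤ 2 →
      ∃ E ∈ hT.halves.parts, N ⊆ E ∧ (E = (T.splitSet D).1 ∨ E = (T.splitSet D).2) := by
    intro N hN hND hN₂
    obtain ⟨E, hE, hNE⟩ := exists_subset_of_weight_le_two hN (subset_univ N) hN₂
    obtain ⟨x, hx⟩ := hN
    have hDE : ¬ Disjoint D E := not_disjoint_iff.2 ⟨x, hND hx, hNE hx⟩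
    exact ⟨E, hE, hNE, (hT.mem_split.1 (hT.mem_split_of_mem_halves hD hE hDE)).2⟩
  obtain ⟨E₁, hE₁, hAE, hE₁D⟩ := half_eq A hA hAD hA₂
  obtain ⟨E₂, hE₂, hBE, hE₂D⟩ := half_eq B hB hBD hB₂
  have hne : E₁ ≠ E₂ := by
    rintro rfl
    exact hext ⟨E₁, hE₁, by simp [hAE, hBE]⟩
  have hDT := hT.subset_points D
  rcases hE₁D with rfl | rfl <;> rcases hE₂D with rfl | rfl
  · exact absurd rfl hne
  · rw [hT.isProper.splitSet_union_of_subset hDT hA hB hAE hBE]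
  · rw [union_comm, hT.isProper.splitSet_union_of_subset hDT hB hA hBE hAE, pair_comm]
  · exact absurd rfl hne

theorem IsLaminarTree.potential_split_lt_of_forall_not_subset (hT : IsLaminarTree P T)
    (hM : FeasibleMerge P C.parts M) (himpure : ∀ D ∈ P.parts, ¬ M.sup id ⊆ D) :
    potential P hT.halves (exchange C hM.1 (hT.split (M.sup id))) < potential P hT.halves C := by
  rw [potential_exchange, hT.sum_weight_split_of_forall_not_subset hM.one_lt_card_sup himpure]
  linarith [hM.weight_sup_lt (H := hT.halves)]

theorem IsLaminarTree.potential_split_le_of_subset (hT : IsLaminarTree P T)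
    (hM : FeasibleMerge P C.parts M) (hD : D ∈ P.parts) (hMD : M.sup id ⊆ D) :
    potential P hT.halves (exchange C hM.1 (hT.split (M.sup id))) ≤ potential P hT.halves C := by
  rw [potential_exchange, hT.sum_weight_split_of_subset hM.one_lt_card_sup hD hMD]
  linarith [hM.four_le_sum_weight (H := hT.halves)]

theorem IsLaminarTree.potential_split_lt_of_subset (hT : IsLaminarTree P T)
    (hM : FeasibleMerge P C.parts M) (hD : D ∈ P.parts) (hMD : M.sup id ⊆ D)
    (hfail : ({(T.splitSet (M.sup id)).1, (T.splitSet (M.sup id)).2} : Finset (Finset X)) ≠ M)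
    (hext : ¬ IsInternal hT.halves M) :
    potential P hT.halves (exchange C hM.1 (hT.split (M.sup id))) < potential P hT.halves C := by
  rw [potential_exchange, hT.sum_weight_split_of_subset hM.one_lt_card_sup hD hMD]
  suffices 4 < ∑ A ∈ M, weight P hT.halves A by linarith
  refine lt_of_not_ge fun hle => hfail ?_
  obtain ⟨hMC, hcard, -⟩ := hM
  obtain ⟨A, B, hAB, rfl⟩ := card_eq_two.1 hcard
  simp only [sup_insert, sup_singleton, id, sup_eq_union, sum_pair hAB] at hMD hle ⊢
  have hA := C.nonempty_of_mem_parts (hMC (mem_insert_self A _))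
  have hB := C.nonempty_of_mem_parts (hMC (mem_insert_of_mem (mem_singleton_self B)))
  have hA₂ := two_le_weight (P := P) (H := hT.halves) hA (subset_univ A)
  have hB₂ := two_le_weight (P := P) (H := hT.halves) hB (subset_univ B)
  exact hT.splitSet_union_pair hA hB hD (subset_union_left.trans hMD)
    (subset_union_right.trans hMD) (by linarith) (by linarith) hext

theorem IsLaminarTree.exists_potential_le_of_feasibleMerge (hT : IsLaminarTree P T)
    (hM : FeasibleMerge P C.parts M) :
    ∃ C' : Clustering X, C'.parts = mergeProc T C.parts M ∧
      potential P hT.halves C' ≤ potential P hT.halves C ∧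
      (¬ IsInternal hT.halves M → potential P hT.halves C' < potential P hT.halves C) := by
  by_cases hsucc :
      ({(T.splitSet (M.sup id)).1, (T.splitSet (M.sup id)).2} : Finset (Finset X)) = M
  · have hne : M.sup id ≠ ⊥ := (card_pos.1 (zero_lt_one.trans hM.one_lt_card_sup)).ne_empty
    have hlt : potential P hT.halves (exchange C hM.1 (.indiscrete hne)) <
        potential P hT.halves C := by
      rw [potential_exchange, Finpartition.indiscrete_parts, sum_singleton]
      linarith [hM.weight_sup_lt (H := hT.halves)]
    refine ⟨exchange C hM.1 (.indiscrete hne), ?_, hlt.le, fun _ => hlt⟩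
    rw [mergeProc, if_pos hsucc, exchange_parts, Finpartition.indiscrete_parts]
  · refine ⟨exchange C hM.1 (hT.split (M.sup id)), ?_, ?_⟩
    · rw [mergeProc, if_neg hsucc, exchange_parts, hT.split_parts hM.one_lt_card_sup]
    by_cases himpure : ∀ D ∈ P.parts, ¬ M.sup id ⊆ D
    · have hlt := hT.potential_split_lt_of_forall_not_subset hM himpure
      exact ⟨hlt.le, fun _ => hlt⟩
    · push Not at himpure
      obtain ⟨D, hD, hMD⟩ := himpure
      exact ⟨hT.potential_split_le_of_subset hM hD hMD,
        hT.potential_split_lt_of_subset hM hD hMD hsucc⟩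

end Response

section CountingMerges

variable {X : Type*} [Fintype X] [DecidableEq X] {P H C : Clustering X} {T : HTree X}
  {A : Finset X} {M : Finset (Finset X)} {N : ℕ}

open Classical in
/-- The feasible merges of two clusters inside the same part of `H`: the response to such a request
may leave the potential unchanged. -/
noncomputable def internalMerges (P H C : Clustering X) : Finset (Finset (Finset X)) :=
  {M ∈ C.parts.powerset | FeasibleMerge P C.parts M ∧ IsInternal H M}

open Classical in
/-- The feasible merges that are not internal: the response to such a request decreases the
potential. -/
noncomputable def externalMerges (P H C : Clustering X) : Finset (Finset (Finset X)) :=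
  {M ∈ C.parts.powerset | FeasibleMerge P C.parts M ∧ ¬ IsInternal H M}

theorem mem_internalMerges :
    M ∈ internalMerges P H C ↔ FeasibleMerge P C.parts M ∧ IsInternal H M := by
  simp only [internalMerges, mem_filter, mem_powerset]
  exact and_iff_right_of_imp fun h => h.1.1

theorem mem_externalMerges :
    M ∈ externalMerges P H C ↔ FeasibleMerge P C.parts M ∧ ¬ IsInternal H M := by
  simp only [externalMerges, mem_filter, mem_powerset]
  exact and_iff_right_of_imp fun h => h.1.1

theorem disjoint_internalMerges_externalMerges :
    Disjoint (internalMerges P H C) (externalMerges P H C) :=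
  disjoint_left.2 fun _ hM hM' => (mem_externalMerges.1 hM').2 (mem_internalMerges.1 hM).2

/-- The partner of `A` is a cluster that meets the other half of the target cluster of `A`. -/
theorem IsLaminarTree.exists_externalMerge (hT : IsLaminarTree P T)
    (hM : M ∈ internalMerges P hT.halves C) (hA : A ∈ M) :
    ∃ G ∈ externalMerges P hT.halves C, A ∈ G := by
  obtain ⟨hfeas, E, hE, hME⟩ := mem_internalMerges.1 hM
  obtain ⟨D, hD, hED⟩ := hT.halves_le hE
  have hcard : 1 < #D := hfeas.one_lt_card_sup.trans_le
    (card_le_card (Finset.sup_le fun B hB => (hME B hB).trans hED))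
  obtain ⟨y, hy⟩ := hT.sdiff_half_nonempty hD hcard hE
  obtain ⟨hyD, hyE⟩ := mem_sdiff.1 hy
  obtain ⟨Z, hZ, hyZ⟩ := C.exists_mem (mem_univ y)
  have hAC := hfeas.1 hA
  obtain ⟨x, hx⟩ := C.nonempty_of_mem_parts hAC
  have hAZ : A ≠ Z := fun h => hyE (hME A hA (h ▸ hyZ))
  refine ⟨{A, Z}, mem_externalMerges.2
    ⟨⟨by simp [insert_subset_iff, hAC, hZ], card_pair hAZ, D, hD, ?_⟩, ?_⟩, mem_insert_self A _⟩
  · simp only [mem_insert, mem_singleton, forall_eq_or_imp, forall_eq]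
    exact ⟨⟨x, mem_inter.2 ⟨hx, hED (hME A hA hx)⟩⟩, ⟨y, mem_inter.2 ⟨hyZ, hyD⟩⟩⟩
  · rintro ⟨E', hE', hAZE'⟩
    have hEE' := hT.halves.eq_of_mem_parts hE hE' (hME A hA hx) (hAZE' A (by simp) hx)
    exact hyE (hEE' ▸ hAZE' Z (by simp) hyZ)

theorem card_internalMerges_filter_mem_le (hHP : H ≤ P)
    (hN : ∀ D ∈ P.parts, meetCount C.parts D ≤ N) (hA : A ∈ C.parts) :
    #{M ∈ internalMerges P H C | A ∈ M} ≤ N := by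
  obtain ⟨x, hx⟩ := C.nonempty_of_mem_parts hA
  obtain ⟨D, hD, hxD⟩ := P.exists_mem (mem_univ x)
  suffices h : {M ∈ internalMerges P H C | A ∈ M} ⊆
      {B ∈ C.parts | ¬ Disjoint D B}.image fun B => {A, B} from
    (card_le_card h).trans (card_image_le.trans (hN D hD))
  intro M hM
  obtain ⟨hM, hAM⟩ := mem_filter.1 hM
  obtain ⟨⟨hMC, hcard, -⟩, E, hE, hME⟩ := mem_internalMerges.1 hM
  obtain ⟨D', hD', hED'⟩ := hHP hE
  obtain rfl := P.eq_of_mem_parts hD hD' hxD (hED' (hME A hAM hx))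
  obtain ⟨B, hB⟩ := card_eq_one.1 (card_erase_of_mem hAM ▸ hcard ▸ rfl : #(M.erase A) = 1)
  have hMAB : M = {A, B} := by rw [← insert_erase hAM, hB]
  have hBM : B ∈ M := by simp [hMAB]
  obtain ⟨y, hy⟩ := C.nonempty_of_mem_parts (hMC hBM)
  exact mem_image.2 ⟨B, mem_filter.2
    ⟨hMC hBM, not_disjoint_iff.2 ⟨y, hED' (hME B hBM hy), hy⟩⟩, hMAB.symm⟩

theorem IsLaminarTree.card_internalMerges_le (hT : IsLaminarTree P T)
    (hN : ∀ D ∈ P.parts, meetCount C.parts D ≤ N) :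
    #(internalMerges P hT.halves C) ≤ 2 * N * #(externalMerges P hT.halves C) := by
  rw [mul_comm, ← mul_one #(internalMerges P hT.halves C)]
  refine card_mul_le_card_mul (fun M G => ¬ Disjoint M G) (fun M hM => ?_) fun G hG => ?_
  · obtain ⟨A, hA⟩ := card_pos.1 ((mem_internalMerges.1 hM).1.2.1 ▸ zero_lt_two)
    obtain ⟨G, hG, hAG⟩ := hT.exists_externalMerge hM hA
    exact card_pos.2 ⟨G, mem_filter.2 ⟨hG, not_disjoint_iff.2 ⟨A, hA, hAG⟩⟩⟩
  · obtain ⟨⟨hGC, hcard, -⟩, -⟩ := mem_externalMerges.1 hG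
    calc #(bipartiteBelow (fun M G => ¬ Disjoint M G) (internalMerges P hT.halves C) G)
        ≤ #(G.biUnion fun A => {M ∈ internalMerges P hT.halves C | A ∈ M}) := by
          refine card_le_card fun M hM => ?_
          obtain ⟨hM, hMG⟩ := mem_filter.1 hM
          obtain ⟨A, hAM, hAG⟩ := not_disjoint_iff.1 hMG
          exact mem_biUnion.2 ⟨A, hAG, mem_filter.2 ⟨hM, hAM⟩⟩
      _ ≤ #G * N := card_biUnion_le_card_mul _ _ _ fun A hA =>
          card_internalMerges_filter_mem_le hT.halves_le hN (hGC hA)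
      _ = 2 * N := by rw [hcard]

end CountingMerges

section NaturalError

variable {X : Type*} [Fintype X] [DecidableEq X] {P C : Clustering X} {A B D : Finset X}
  {γ : Clustering X → Clustering X → ℤ}

theorem IsNaturalError.exists_lt_of_split (hγ : IsNaturalError γ) (hA : A ∈ C.parts)
    (hD : D ∈ P.parts) (hne₁ : (A ∩ D).Nonempty) (hne₂ : (A \ D).Nonempty) :
    ∃ C' : Clustering X, γ C' P < γ C P ∧ correctionCost P C = correctionCost P C' + 1 := by
  have hdisj : Disjoint (A ∩ D) (A \ D) := (disjoint_sdiff_inter A D).symm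
  have hunion : A ∩ D ∪ A \ D = A := union_comm (A \ D) _ ▸ sdiff_union_inter A D
  have hmeet : ∀ E ∈ P.parts, Disjoint (A ∩ D) E ∨ Disjoint (A \ D) E := fun E hE => by
    by_cases h : D = E
    · exact .inr (h ▸ sdiff_disjoint)
    · exact .inl ((P.disjoint hD hE h).mono_left inter_subset_right)
  refine ⟨exchange C (singleton_subset_iff.2 hA)
    ((pairPartition hdisj hunion).copy (sup_singleton (f := id)).symm),
    hγ.split_lt P C _ A hA D hD hne₁ hne₂ ?_, ?_⟩
  · rw [exchange_parts, Finpartition.copy_parts, pairPartition_parts hne₁ hne₂,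
      sdiff_singleton_eq_erase]
  · rw [correctionCost_exchange, Finpartition.copy_parts, pairPartition_parts hne₁ hne₂,
      sum_singleton, sum_pair (hdisj.ne hne₁.ne_empty), ← hunion,
      meetCount_union_of_forall_disjoint hmeet, hunion]
    push_cast
    ring

theorem IsNaturalError.exists_lt_of_merge (hγ : IsNaturalError γ) (hA : A ∈ C.parts)
    (hB : B ∈ C.parts) (hAB : A ≠ B) (hD : D ∈ P.parts) (hAD : A ⊆ D) (hBD : B ⊆ D) :
    ∃ C' : Clustering X, γ C' P < γ C P ∧ correctionCost P C = correctionCost P C' + 1 := by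
  have hsup : ({A, B} : Finset (Finset X)).sup id = A ∪ B := by simp
  have hAne := C.nonempty_of_mem_parts hA
  have hne : ({A, B} : Finset (Finset X)).sup id ≠ ⊥ :=
    hsup ▸ (hAne.mono subset_union_left).ne_empty
  refine ⟨exchange C (by simp [insert_subset_iff, hA, hB]) (.indiscrete hne),
    hγ.merge_lt P C _ A hA B hB hAB ⟨D, hD, hAD, hBD⟩ ?_, ?_⟩
  · rw [exchange_parts, Finpartition.indiscrete_parts, hsup]
  · rw [correctionCost_exchange, Finpartition.indiscrete_parts, sum_singleton, sum_pair hAB, hsup,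
      meetCount_parts_of_subset hD hAne hAD,
      meetCount_parts_of_subset hD (C.nonempty_of_mem_parts hB) hBD,
      meetCount_parts_of_subset hD (hAne.mono subset_union_left) (union_subset hAD hBD)]
    ring

theorem IsNaturalError.exists_lt (hγ : IsNaturalError γ) (hne : C ≠ P) :
    ∃ C' : Clustering X, γ C' P < γ C P ∧ correctionCost P C = correctionCost P C' + 1 := by
  rcases exists_improvement hne with
    ⟨A, hA, D, hD, hne₁, hne₂⟩ | ⟨A, hA, B, hB, hAB, D, hD, hAD, hBD⟩
  · exact hγ.exists_lt_of_split hA hD hne₁ hne₂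
  · exact hγ.exists_lt_of_merge hA hB hAB hD hAD hBD

theorem IsNaturalError.pos (hγ : IsNaturalError γ) (hne : C ≠ P) : 0 < γ C P :=
  have ⟨C', hlt, _⟩ := hγ.exists_lt hne
  (hγ.nonneg C' P).trans_lt hlt

theorem IsNaturalError.correctionCost_le (hγ : IsNaturalError γ) (P C : Clustering X) :
    correctionCost P C ≤ γ C P := by
  induction hn : (γ C P).toNat using Nat.strong_induction_on generalizing C with
  | _ n ih =>
    by_cases hne : C = P
    · rw [hne, correctionCost_self]
      exact hγ.nonneg P P
    obtain ⟨C', hlt, hcost⟩ := hγ.exists_lt hne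
    have hC' := hγ.nonneg C' P
    linarith [ih _ (by lia) C' rfl]

end NaturalError

section Mean

variable {α β : Type*} (p : PMF α) {f : α → ℝ≥0∞} {a : ℝ≥0∞} {s t : Finset α} {K : ℕ}

/-- The expectation of `f` under the discrete law `p`. -/
noncomputable def mean (p : PMF α) (f : α → ℝ≥0∞) : ℝ≥0∞ :=
  ∑' a, p a * f a

theorem mean_bind (q : α → PMF β) (f : β → ℝ≥0∞) :
    mean (p.bind q) f = mean p fun a => mean (q a) f := by
  simp only [mean, PMF.bind_apply, ← ENNReal.tsum_mul_right, ← ENNReal.tsum_mul_left]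
  rw [ENNReal.tsum_comm]
  simp only [mul_assoc]

theorem mean_pure (a : α) (f : α → ℝ≥0∞) : mean (PMF.pure a) f = f a := by
  rw [mean, tsum_eq_single a fun b hb => by simp [hb], PMF.pure_apply_self, one_mul]

theorem mean_map (g : α → β) (f : β → ℝ≥0∞) : mean (p.map g) f = mean p (f ∘ g) := by
  rw [← PMF.bind_pure_comp, mean_bind]
  simp only [Function.comp_def, mean_pure]

theorem mean_const_mul (f : α → ℝ≥0∞) (a : ℝ≥0∞) : (mean p fun x => a * f x) = a * mean p f := by
  simp only [mean, mul_left_comm _ a, ENNReal.tsum_mul_left]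

variable {p}

theorem mean_le_mean {g : α → ℝ≥0∞} (h : ∀ x ∈ p.support, f x ≤ g x) : mean p f ≤ mean p g := by
  refine ENNReal.tsum_le_tsum fun x => ?_
  rcases eq_or_ne (p x) 0 with hx | hx
  · simp [hx]
  · exact mul_le_mul_right (h x hx) _

theorem mean_le_half_add_half (hle : ∀ x ∈ p.support, f x ≤ a)
    (hhalf : ∀ x ∈ p.support, x ∉ s → f x ≤ a / 2) :
    mean p f ≤ (2⁻¹ + (∑ x ∈ s, p x) * 2⁻¹) * a := by
  classical
  calc mean p f ≤ mean p fun x => (2⁻¹ + if x ∈ s then 2⁻¹ else 0) * a := by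
        refine mean_le_mean fun x hx => ?_
        split_ifs with hxs
        · simpa [ENNReal.inv_two_add_inv_two] using hle x hx
        · simpa [mul_comm, div_eq_mul_inv] using hhalf x hx hxs
    _ = (2⁻¹ + (∑ x ∈ s, p x) * 2⁻¹) * a := by
        simp only [mean, ← mul_assoc, mul_add, mul_ite, mul_zero, ENNReal.tsum_mul_right,
          ENNReal.tsum_add, p.tsum_coe, one_mul]
        rw [tsum_eq_sum (s := s) fun x hx => if_neg hx, sum_congr rfl fun x hx => if_pos hx,
          sum_mul]

theorem sum_le_div_add_one (hst : Disjoint s t) (hK : ∑ x ∈ s, p x ≤ K * ∑ x ∈ t, p x) :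
    ∑ x ∈ s, p x ≤ K / (K + 1) := by
  classical
  have hone : ∑ x ∈ s, p x + ∑ x ∈ t, p x ≤ 1 := by
    rw [← sum_union hst, ← p.tsum_coe]
    exact ENNReal.sum_le_tsum _
  rw [ENNReal.le_div_iff_mul_le (by simp) (by simp)]
  calc (∑ x ∈ s, p x) * (K + 1) = K * ∑ x ∈ s, p x + ∑ x ∈ s, p x := by ring
    _ ≤ K * ∑ x ∈ s, p x + K * ∑ x ∈ t, p x := by gcongr
    _ = K * (∑ x ∈ s, p x + ∑ x ∈ t, p x) := by ring
    _ ≤ K := mul_le_of_le_one_right' hone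

theorem half_add_div_mul_half (K : ℕ) :
    (2⁻¹ + K / (K + 1) * 2⁻¹ : ℝ≥0∞) = ENNReal.ofReal (1 - 1 / (2 * (K + 1))) := by
  have hreal : (1 : ℝ) - 1 / (2 * (K + 1)) = 2⁻¹ + K / (K + 1) * 2⁻¹ := by
    field_simp
    ring
  rw [hreal, ENNReal.ofReal_add (by positivity) (by positivity),
    ENNReal.ofReal_mul (by positivity), ENNReal.ofReal_div_of_pos (by positivity),
    ENNReal.ofReal_add (by positivity) one_pos.le, ENNReal.ofReal_inv_of_pos two_pos]
  simp

theorem mean_le_of_sum_le (hst : Disjoint s t) (hK : ∑ x ∈ s, p x ≤ K * ∑ x ∈ t, p x)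
    (hle : ∀ x ∈ p.support, f x ≤ a) (hhalf : ∀ x ∈ p.support, x ∉ s → f x ≤ a / 2) :
    mean p f ≤ ENNReal.ofReal (1 - 1 / (2 * (K + 1))) * a := by
  refine (mean_le_half_add_half hle hhalf).trans ?_
  rw [← half_add_div_mul_half]
  gcongr
  exact sum_le_div_add_one hst hK

end Mean

section History

variable {X : Type*} [Fintype X] [DecidableEq X] {T : HTree X} {P C₀ : Clustering X}
  {user : List (Request X) → PMF (Request X)} {V : Finset (Finset X) → ℝ≥0∞} {ρ : ℝ≥0∞}

theorem mean_history_le (hV : V P.parts = 0)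
    (hstep : ∀ n, ∀ h ∈ (history T P C₀ user n).support, current T C₀.parts h ≠ P.parts →
      (mean (user h) fun r => V (respond T (current T C₀.parts h) r)) ≤
        ρ * V (current T C₀.parts h)) (n : ℕ) :
    (mean (history T P C₀ user n) fun h => V (current T C₀.parts h)) ≤ ρ ^ n * V C₀.parts := by
  induction n with
  | zero => rw [history, mean_pure, current, pow_zero, one_mul]
  | succ n ih =>
    rw [history, mean_bind, pow_succ', mul_assoc]
    refine (mean_le_mean fun h hh => ?_).trans
      ((mean_const_mul _ _ ρ).le.trans (mul_le_mul_right ih ρ))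
    split_ifs with hP
    · rw [mean_pure, hP, hV, mul_zero]
    · rw [mean_map]
      exact hstep n h hh hP

theorem one_le_probFoundWithin_add_mean (hV : ∀ C ≠ P.parts, 1 ≤ V C) (n : ℕ) :
    1 ≤ probFoundWithin T P C₀ user n +
      mean (history T P C₀ user n) fun h => V (current T C₀.parts h) := by
  rw [← (history T P C₀ user n).tsum_coe, probFoundWithin, PMF.toOuterMeasure_apply, mean,
    ← ENNReal.tsum_add]
  refine ENNReal.tsum_le_tsum fun h => ?_
  by_cases hP : current T C₀.parts h = P.parts
  · rw [Set.indicator_of_mem (by exact hP)]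
    exact le_self_add
  · exact (le_mul_of_one_le_right' (hV _ hP)).trans le_add_self

end History

section Interaction

variable {X : Type*} [Fintype X] [DecidableEq X] {T : HTree X} {P H C C' C₀ : Clustering X}
  {p : PMF (Request X)} {user : List (Request X) → PMF (Request X)} {r : Request X} {N : ℕ}

theorem IsLaminarTree.exists_potential_le_of_feasible (hT : IsLaminarTree P T)
    (hr : Feasible P C.parts r) :
    ∃ C' : Clustering X, C'.parts = respond T C.parts r ∧
      potential P hT.halves C' ≤ potential P hT.halves C ∧
      ((∀ M ∈ internalMerges P hT.halves C, r ≠ .merge M) →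
        potential P hT.halves C' < potential P hT.halves C) := by
  cases r with
  | split A =>
    obtain ⟨C', hC', hlt⟩ := hT.exists_potential_lt_of_feasibleSplit hr
    exact ⟨C', hC', hlt.le, fun _ => hlt⟩
  | merge M =>
    obtain ⟨C', hC', hle, hlt⟩ := hT.exists_potential_le_of_feasibleMerge hr
    exact ⟨C', hC', hle, fun hM => hlt fun h => hM M (mem_internalMerges.2 ⟨hr, h⟩) rfl⟩

/-- The exponential of the potential of a clustering, set to zero at the target `P`. It is defined
for all families of sets because the interaction runs on these. -/
noncomputable def expPotential (P H : Clustering X) (C : Finset (Finset X)) : ℝ≥0∞ :=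
  if C = P.parts then 0 else 2 ^ (∑ A ∈ C, weight P H A - ∑ D ∈ P.parts, weight P H D).toNat

theorem expPotential_target (P H : Clustering X) : expPotential P H P.parts = 0 :=
  if_pos rfl

theorem expPotential_of_ne (hC : C.parts ≠ P.parts) :
    expPotential P H C.parts = 2 ^ (potential P H C).toNat :=
  if_neg hC

theorem expPotential_le_two_pow (C : Clustering X) :
    expPotential P H C.parts ≤ 2 ^ (potential P H C).toNat := by
  rw [expPotential]
  split_ifs
  exacts [zero_le, le_rfl]

theorem one_le_expPotential {C : Finset (Finset X)} (hC : C ≠ P.parts) :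
    1 ≤ expPotential P H C := by
  rw [expPotential, if_neg hC]
  exact one_le_pow₀ one_le_two

theorem expPotential_le (hC : C.parts ≠ P.parts) (hle : potential P H C' ≤ potential P H C) :
    expPotential P H C'.parts ≤ expPotential P H C.parts := by
  rw [expPotential_of_ne hC]
  exact (expPotential_le_two_pow C').trans
    (pow_le_pow_right₀ one_le_two (Int.toNat_le_toNat hle))

theorem expPotential_le_half (hHP : H ≤ P) (hC : C.parts ≠ P.parts)
    (hlt : potential P H C' < potential P H C) :
    expPotential P H C'.parts ≤ expPotential P H C.parts / 2 := by
  have hpos := potential_nonneg hHP C'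
  rw [expPotential_of_ne hC, ENNReal.le_div_iff_mul_le (by simp) (by simp)]
  calc expPotential P H C'.parts * 2 ≤ 2 ^ (potential P H C').toNat * 2 := by
        gcongr
        exact expPotential_le_two_pow C'
    _ = 2 ^ ((potential P H C').toNat + 1) := (pow_succ _ _).symm
    _ ≤ 2 ^ (potential P H C).toNat := pow_le_pow_right₀ one_le_two (by lia)

theorem IsLaminarTree.sum_internalMerges_le (hT : IsLaminarTree P T)
    (hN : ∀ D ∈ P.parts, meetCount C.parts D ≤ N)
    (hunif : ∀ M M', FeasibleMerge P C.parts M → FeasibleMerge P C.parts M' →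
      p (.merge M) = p (.merge M')) :
    ∑ M ∈ internalMerges P hT.halves C, p (.merge M) ≤
      (2 * N : ℕ) * ∑ M ∈ externalMerges P hT.halves C, p (.merge M) := by
  rcases (internalMerges P hT.halves C).eq_empty_or_nonempty with hempty | ⟨M₀, hM₀⟩
  · simp [hempty]
  have hfeas := (mem_internalMerges.1 hM₀).1
  rw [sum_congr rfl fun M hM => hunif M M₀ (mem_internalMerges.1 hM).1 hfeas,
    sum_congr rfl fun M hM => hunif M M₀ (mem_externalMerges.1 hM).1 hfeas,
    sum_const, sum_const, nsmul_eq_mul, nsmul_eq_mul, ← mul_assoc]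
  gcongr
  exact_mod_cast hT.card_internalMerges_le hN

/-- Merge requests, as an injective function of the requested pair. -/
def mergeEmbedding (X : Type*) : Finset (Finset X) ↪ Request X :=
  ⟨.merge, fun _ _ h => Request.merge.inj h⟩

theorem IsLaminarTree.mean_expPotential_respond_le (hT : IsLaminarTree P T)
    (hC : C.parts ≠ P.parts) (hN : potential P hT.halves C + 1 ≤ N)
    (hfeas : ∀ r ∈ p.support, Feasible P C.parts r)
    (hunif : ∀ M M', FeasibleMerge P C.parts M → FeasibleMerge P C.parts M' →
      p (.merge M) = p (.merge M')) :
    (mean p fun r => expPotential P hT.halves (respond T C.parts r)) ≤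
      ENNReal.ofReal (1 - 1 / (2 * ((2 * N : ℕ) + 1))) * expPotential P hT.halves C.parts := by
  have hmeet : ∀ D ∈ P.parts, meetCount C.parts D ≤ N := fun D hD =>
    mod_cast (meetCount_le_potential_add_one hT.halves_le C hD).trans hN
  refine mean_le_of_sum_le (s := (internalMerges P hT.halves C).map (mergeEmbedding X))
    (t := (externalMerges P hT.halves C).map (mergeEmbedding X))
    ((disjoint_map _).2 disjoint_internalMerges_externalMerges) ?_ (fun r hr => ?_)
    fun r hr hint => ?_
  · rw [sum_map, sum_map]
    exact hT.sum_internalMerges_le hmeet hunif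
  · obtain ⟨C', hC', hle, -⟩ := hT.exists_potential_le_of_feasible (hfeas r hr)
    exact hC' ▸ expPotential_le hC hle
  · obtain ⟨C', hC', -, hlt⟩ := hT.exists_potential_le_of_feasible (hfeas r hr)
    exact hC' ▸ expPotential_le_half hT.halves_le hC
      (hlt fun M hM h => hint (mem_map.2 ⟨M, hM, h.symm⟩))

theorem IsLaminarTree.exists_current_eq_parts (hT : IsLaminarTree P T)
    (huser : IsUnrestrictedRandomMergeUser T P C₀ user) (n : ℕ) :
    ∀ h ∈ (history T P C₀ user n).support, ∃ C : Clustering X,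
      C.parts = current T C₀.parts h ∧ potential P hT.halves C ≤ potential P hT.halves C₀ := by
  induction n with
  | zero =>
    intro h hh
    rw [history, PMF.support_pure, Set.mem_singleton_iff] at hh
    exact ⟨C₀, by rw [hh, current], le_rfl⟩
  | succ n ih =>
    intro h hh
    rw [history, PMF.mem_support_bind_iff] at hh
    obtain ⟨h', hh', hh⟩ := hh
    split_ifs at hh with hP
    · rw [PMF.support_pure, Set.mem_singleton_iff] at hh
      exact hh ▸ ih h' hh'
    · rw [PMF.mem_support_map_iff] at hh
      obtain ⟨r, hr, rfl⟩ := hh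
      obtain ⟨C, hC, hle⟩ := ih h' hh'
      have hfeas : Feasible P C.parts r := hC ▸ (huser n h' hh' hP).1 r hr
      obtain ⟨C', hC', hle', -⟩ := hT.exists_potential_le_of_feasible hfeas
      exact ⟨C', by rw [hC', hC, current], hle'.trans hle⟩

theorem IsLaminarTree.one_le_probFoundWithin_add (hT : IsLaminarTree P T)
    (huser : IsUnrestrictedRandomMergeUser T P C₀ user) (hN : potential P hT.halves C₀ + 1 ≤ N)
    (n : ℕ) :
    1 ≤ probFoundWithin T P C₀ user n +
      ENNReal.ofReal (1 - 1 / (2 * ((2 * N : ℕ) + 1))) ^ n *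
        expPotential P hT.halves C₀.parts := by
  refine (one_le_probFoundWithin_add_mean (fun C => one_le_expPotential) n).trans
    (add_le_add_right (mean_history_le (expPotential_target P hT.halves) ?_ n) _)
  intro n h hh hP
  obtain ⟨C, hC, hle⟩ := hT.exists_current_eq_parts huser n h hh
  obtain ⟨hfeas, hunif⟩ := huser n h hh hP
  rw [← hC] at hP hfeas hunif ⊢
  exact hT.mean_expPotential_respond_le hP (by linarith) hfeas hunif

end Interaction

section RoundCount

variable {ε k : ℝ} {n : ℕ}

theorem one_sub_inv_pow_mul_two_pow_le {c : ℝ} (hc : 1 ≤ c) (hε : 0 < ε) {m : ℕ}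
    (h : m * Real.log 2 - Real.log ε ≤ n / c) : (1 - 1 / c) ^ n * 2 ^ m ≤ ε :=
  have hbase : 0 ≤ 1 - 1 / c := sub_nonneg.2 ((div_le_one (by positivity)).2 hc)
  calc (1 - 1 / c) ^ n * 2 ^ m
      ≤ Real.exp (-(1 / c)) ^ n * Real.exp (Real.log 2) ^ m := by
        rw [Real.exp_log two_pos]
        gcongr
        exact Real.one_sub_le_exp_neg _
    _ = Real.exp (m * Real.log 2 - n / c) := by
        rw [← Real.exp_nat_mul, ← Real.exp_nat_mul, ← Real.exp_add]
        ring_nf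
    _ ≤ ε := (Real.le_log_iff_exp_le hε).1 (by linarith)

theorem mul_log_two_sub_log_le {g m : ℕ} (hg : 1 ≤ g) (hm : m ≤ 3 * g) (hk : 1 ≤ k) (hε : 0 < ε)
    (hkε : 2 ≤ k / ε) (hn : 100 * (Real.log (k / ε) * g ^ 2) < n + 1) :
    m * Real.log 2 - Real.log ε ≤ n / (12 * g + 6) := by
  have hg' : (1 : ℝ) ≤ g := mod_cast hg
  have hm' : (m : ℝ) ≤ 3 * g := mod_cast hm
  set L := Real.log (k / ε) with hL
  have hlog : Real.log 2 ≤ L := Real.log_le_log two_pos hkε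
  have hlogε : -Real.log ε ≤ L := by
    rw [hL, Real.log_div (by positivity) hε.ne']
    linarith [Real.log_nonneg hk]
  have hL₀ : 1 / 2 ≤ L := by linarith [Real.log_two_gt_d9]
  have hLg : 1 / 2 ≤ L * g ^ 2 := hL₀.trans (le_mul_of_one_le_right (by linarith) (one_le_pow₀ hg'))
  rw [le_div_iff₀ (by positivity)]
  calc (m * Real.log 2 - Real.log ε) * (12 * g + 6)
      ≤ (3 * g * L + L * g) * (12 * g + 6 * g) := by
        have hmL : m * Real.log 2 ≤ 3 * g * L := by gcongr
        have hLg' : L ≤ L * g := le_mul_of_one_le_right (by linarith) hg'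
        gcongr <;> linarith
    _ = 72 * (L * g ^ 2) := by ring
    _ ≤ n := by linarith

theorem rate_pow_mul_two_pow_le {g m : ℕ} (hg : 1 ≤ g) (hm : m ≤ 3 * g) (hk : 1 ≤ k) (hε : 0 < ε)
    (hkε : 2 ≤ k / ε) (hn : 100 * (Real.log (k / ε) * g ^ 2) < n + 1) :
    ENNReal.ofReal (1 - 1 / (2 * ((2 * (3 * g + 1) : ℕ) + 1))) ^ n * 2 ^ m ≤
      ENNReal.ofReal ε := by
  have hc : (2 * ((2 * (3 * g + 1) : ℕ) + 1) : ℝ) = 12 * g + 6 := by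
    push_cast
    ring
  have hc₁ : (1 : ℝ) ≤ 12 * g + 6 := by linarith [g.cast_nonneg (α := ℝ)]
  have hbase : (0 : ℝ) ≤ 1 - 1 / (12 * g + 6) :=
    sub_nonneg.2 ((div_le_one (by positivity)).2 hc₁)
  rw [hc, ← ENNReal.ofReal_pow hbase, ← ENNReal.ofReal_ofNat 2, ← ENNReal.ofReal_pow two_pos.le,
    ← ENNReal.ofReal_mul (pow_nonneg hbase n)]
  exact ENNReal.ofReal_le_ofReal (one_sub_inv_pow_mul_two_pow_le hc₁ hε
    (mul_log_two_sub_log_le hg hm hk hε hkε hn))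

end RoundCount

end InteractiveClustering

theorem mainTheorem9_general {X : Type*} [Fintype X] [DecidableEq X] {Cstar C₀ : Clustering X}
    {T : HTree X} (hT : IsLaminarTree Cstar T) {γ : Clustering X → Clustering X → ℤ}
    (hγ : IsNaturalError γ) {user : List (Request X) → PMF (Request X)}
    (huser : IsUnrestrictedRandomMergeUser T Cstar C₀ user) {ε : ℝ} (hε : 0 < ε)
    (hkε : 2 ≤ (Cstar.parts.card : ℝ) / ε) :
    ENNReal.ofReal (1 - ε) ≤ probFoundWithin T Cstar C₀ user
      ⌊100 * (Real.log ((Cstar.parts.card : ℝ) / ε) * (γ C₀ Cstar : ℝ) ^ 2)⌋₊ := by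
  set n := ⌊100 * (Real.log ((Cstar.parts.card : ℝ) / ε) * (γ C₀ Cstar : ℝ) ^ 2)⌋₊ with hn
  obtain ⟨g, hg⟩ := Int.eq_ofNat_of_zero_le (hγ.nonneg C₀ Cstar)
  have hpot : potential Cstar hT.halves C₀ ≤ 3 * g := by
    have hcost := potential_le_three_mul_correctionCost hT.halves_le
      (fun _ => hT.meetCount_halves_le_two) C₀
    linarith [hγ.correctionCost_le Cstar C₀]
  have hfound := hT.one_le_probFoundWithin_add huser (N := 3 * g + 1) (by push_cast; linarith) n
  rw [ENNReal.ofReal_sub _ hε.le, ENNReal.ofReal_one, tsub_le_iff_right]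
  refine hfound.trans (add_le_add_right ?_ _)
  by_cases hC₀ : C₀.parts = Cstar.parts
  · simp [hC₀, expPotential_target]
  have hg₁ : 1 ≤ g := by
    have hpos := hγ.pos fun h => hC₀ (congrArg Finpartition.parts h)
    lia
  have hk : (1 : ℝ) ≤ Cstar.parts.card := by
    refine Nat.one_le_cast.2 (Nat.one_le_iff_ne_zero.2 fun h => ?_)
    norm_num [h] at hkε
  rw [expPotential_of_ne hC₀]
  refine rate_pow_mul_two_pow_le hg₁ (by lia) hk hε hkε ?_
  rw [hn, hg]
  exact Nat.lt_floor_add_one _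

theorem mainTheorem9 :
    ∃ K : ℝ, 0 < K ∧
      ∀ (X : Type*) [Fintype X] [DecidableEq X]
        (S : X → X → ℝ) (_ : ∀ x y, S x y = S y x)
        (Cstar : Clustering X) (_ : IsStable S Cstar)
        (T : HTree X) (_ : IsAvgLinkageTree S T)
        (γ : Clustering X → Clustering X → ℤ) (_ : IsNaturalError γ)
        (C₀ : Clustering X)
        (user : List (Request X) → PMF (Request X))
        (_ : IsUnrestrictedRandomMergeUser T Cstar C₀ user)
        (ε : ℝ) (_ : 0 < ε) (_ : ε < 1) (_ : 2 ≤ (Cstar.parts.card : ℝ) / ε),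
        ENNReal.ofReal (1 - ε) ≤
          probFoundWithin T Cstar C₀ user
            ⌊K * (Real.log ((Cstar.parts.card : ℝ) / ε) * (γ C₀ Cstar : ℝ) ^ 2)⌋₊ :=
  ⟨100, by norm_num, fun _ _ _ _ hS _ hstable _ hT _ hγ _ _ huser _ hε _ hkε =>
    mainTheorem9_general (hstable.isLaminarTree hS hT) hγ huser hε hkε⟩
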